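/- Let $G$ be a finite graph (multiple edges allowed) embedded in the cylinder $\Sigma=S^1\times[0,1]$ and inducing a cellular decomposition of $\Sigma$ with vertex set $V$, edge set $E$ and face set $F$, where closed faces are discs (the boundary of every face is a simple cycle) and the boundary circles $S^1\times\{0\}$, $S^1\times\{1\}$ are disjoint simple cycles of $G$. Assume that (G1) $|V|=2n$ is even; (G2) every vertex has degree $3$; (G3) the boundary of every face has even length; (G4) both boundary circles have odd length. Let $c_u$ $(u\in V)$ be Majorana modes, i.e. self-adjoint operators with $c_uc_v+c_vc_u=2\delta_{uv}I$ on a Hilbert space of dimension $2^n$. For $A\subseteq V$ let $c_A=\prod_{u\in A}c_u$, the product taken in a fixed linear order of $V$. The group of Majorana operators is generated by the $c_u$ and the phase $i$; its elements are $\eta c_A$ with $\eta\in\{\pm1,\pm i\}$, and $\eta c_A$ has even (odd) weight if $|A|$ is even (odd). For $f\in F$ let $C_f=c_{V(f)}$, where $V(f)$ is the set of vertices on the boundary of $f$. For $\alpha\in\{0,1\}$ let $\bar C_\alpha=c_{\gamma_\alpha}$, where $\gamma_\alpha=V\cap(S^1\times\{\alpha\})$. Then there are phases $\eta_f\in\{\pm1,\pm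 i\}$ such that the group $\mathcal S=\langle \eta_fC_f : f\in F\rangle$ is abelian and does not contain $-I$. For every such choice of phases $\mathcal S$ is the stabilizer group of a Majorana fermion code (an abelian group of even-weight Majorana operators not containing $-I$), called a Majorana color code of $G$, and this code encodes exactly one logical qubit, $k=1$: $\mathcal S$ is generated by $n-1$ independent generators, and the codespace (the space of vectors invariant under $\mathcal S$) has dimension $2$. Let $\mathcal C(\mathcal S)$ be the group of Majorana operators that commute with all elements of $\mathcal S$. The boundary operators $\bar C_0,\bar C_1$ have odd weight and are logical operators, that is, they lie in $\mathcal C(\mathcal S)\setminus\mathcal S$. Up to phase factors they are the logical Pauli operators of the encoded qubit: there are $\eta_0,\eta_1\in\{\pm1,\pm i\}$ such that $\bar X=\eta_0\bar C_0$, $\bar Y=\eta_1\bar C_1$ and $\bar Z=-i\bar X\bar Y$ are self-adjoint elements of $\mathcal C(\mathcal S)\setminus\mathcal S$ that satisfy the relations of the Pauli matrices, and $\mathcal C(\mathcal S)=\langle i,\mathcal S,\bar X,\bar Y,\bar Z\rangle$. -/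

import Mathlib

/-- A combinatorial map (rotation system) with set of darts (oriented edges) `D`: a graph, loops and
multiple edges allowed, cellularly embedded in a closed oriented surface. The edge reversal `α`
is an involution without fixed points, and `σ` rotates the darts around their source vertices. -/
structure CombinatorialMap (D : Type*) where
  /-- The next dart with the same source, in the cyclic order around this vertex. -/
  σ : Equiv.Perm D
  /-- The same edge, traversed in the opposite direction. -/
  α : Equiv.Perm D
  α_α : ∀ d, α (α d) = d
  α_ne : ∀ d, α d ≠ d

namespace CombinatorialMap

variable {D : Type*} (M : CombinatorialMap D)

/-- The next dart along the boundary walk of the face that contains a given dart. -/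
def φ : Equiv.Perm D := M.σ * M.α

/-- Vertices are the cycles of `σ`. -/
def Vertex : Type _ := Quotient (Equiv.Perm.SameCycle.setoid M.σ)

/-- Faces are the cycles of `φ`. -/
def Face : Type _ := Quotient (Equiv.Perm.SameCycle.setoid M.φ)

/-- The source vertex of a dart. -/
def source (d : D) : M.Vertex := Quotient.mk (Equiv.Perm.SameCycle.setoid M.σ) d

/-- The target vertex of a dart. -/
def target (d : D) : M.Vertex := M.source (M.α d)

/-- The face whose boundary walk contains a dart. Every edge has two sides: the faces of its
two darts. -/
def face (d : D) : M.Face := Quotient.mk (Equiv.Perm.SameCycle.setoid M.φ) d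

instance [Finite D] : Finite M.Vertex :=
  inferInstanceAs (Finite (Quotient (Equiv.Perm.SameCycle.setoid M.σ)))

instance [Finite D] : Finite M.Face :=
  inferInstanceAs (Finite (Quotient (Equiv.Perm.SameCycle.setoid M.φ)))

/-- `M.IsWalk v l w`: the list `l` of darts is a walk from the vertex `v` to the vertex `w`. -/
inductive IsWalk : M.Vertex → List D → M.Vertex → Prop
  | nil (v : M.Vertex) : IsWalk v [] v
  | cons (d : D) {l : List D} {w : M.Vertex} (h : IsWalk (M.target d) l w) :
      IsWalk (M.source d) (d :: l) w

/-- The boundary walk of the face of `d`, started at `d` and traversed once. -/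
noncomputable def faceWalk (d : D) : List D :=
  List.iterate M.φ d (Function.minimalPeriod M.φ d)

/-- The relations of edge-path homotopy: a dart followed by its reverse is trivial, and so is the
boundary walk of each face. -/
def homotopyRels : Set (FreeGroup D) :=
  Set.range (fun d => FreeGroup.of d * FreeGroup.of (M.α d)) ∪
    Set.range (fun d => ((M.faceWalk d).map FreeGroup.of).prod)

/-- The surface is connected. -/
def IsConnected : Prop :=
  ∀ v w : M.Vertex, ∃ l, M.IsWalk v l w

/-- Every closed walk is null-homotopic. (Modulo the relations, the darts generate the free
product of the fundamental group with a free group, so that a closed walk has the value `1`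
exactly if it is null-homotopic.) -/
def IsSimplyConnected : Prop :=
  ∀ (v : M.Vertex) (l : List D), M.IsWalk v l v →
    (l.map (PresentedGroup.of (rels := M.homotopyRels))).prod = 1

/-- The set of vertices on the boundary of a face. -/
noncomputable def faceVertices [Finite D] (f : M.Face) : Finset M.Vertex :=
  (Set.toFinite {v | ∃ d, M.source d = v ∧ M.face d = f}).toFinset

/-- The length of the boundary of a face. -/
noncomputable def faceLength (f : M.Face) : ℕ := Nat.card {d // M.face d = f}

/-- The degree of a vertex (a loop counts twice). -/
noncomputable def degree (v : M.Vertex) : ℕ := Nat.card {d // M.source d = v}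

end CombinatorialMap

/-- A finite cellular decomposition of the cylinder `S¹ × [0,1]`. Patching the two holes of the
cylinder with two discs gives a sphere, that is, a closed surface that is connected and simply
connected. So the data are a cellular decomposition of the sphere together with two external faces
`ext 0`, `ext 1` whose boundaries, the boundary circles `S¹ × {0}` and `S¹ × {1}`, are disjoint
simple cycles. The faces of the cylinder are all the other faces. The closed faces are discs: no
boundary walk visits a vertex twice. -/
structure CylinderDecomposition (D : Type*) extends CombinatorialMap D where
  connected : toCombinatorialMap.IsConnected
  simplyConnected : toCombinatorialMap.IsSimplyConnected
  faceBoundary_simple : ∀ d e, toCombinatorialMap.source d = toCombinatorialMap.source e →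
    toCombinatorialMap.face d = toCombinatorialMap.face e → d = e
  ext : Fin 2 → toCombinatorialMap.Face
  ext_disjoint : ∀ d e, toCombinatorialMap.face d = ext 0 → toCombinatorialMap.face e = ext 1 →
    toCombinatorialMap.source d ≠ toCombinatorialMap.source e

namespace CylinderDecomposition

variable {D : Type*} (G : CylinderDecomposition D)

/-- The vertices of the graph. -/
abbrev Vertex : Type _ := G.toCombinatorialMap.Vertex

/-- The faces of the cylinder: all faces except the two external ones. -/
def Face : Type _ := {f : G.toCombinatorialMap.Face // ∀ a, f ≠ G.ext a}

/-- `V(f)`, the vertices on the boundary of the face `f` of the cylinder. -/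
noncomputable def faceVertices [Finite D] (f : G.Face) : Finset G.Vertex :=
  G.toCombinatorialMap.faceVertices f.1

/-- `γ_a`, the vertices on the boundary circle `S¹ × {a}`. -/
noncomputable def boundaryVertices [Finite D] (a : Fin 2) : Finset G.Vertex :=
  G.toCombinatorialMap.faceVertices (G.ext a)

/-- The conditions on the graph of a Majorana color code. -/
structure IsColorGraph : Prop where
  /-- The number of vertices is even. -/
  even_card : Even (Nat.card G.Vertex)
  /-- The graph is trivalent. -/
  trivalent : ∀ v, G.toCombinatorialMap.degree v = 3
  /-- The boundary of any face has even length. -/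
  even_face : ∀ f : G.Face, Even (G.toCombinatorialMap.faceLength f.1)
  /-- The two boundary circles have odd length. -/
  odd_boundary : ∀ a, Odd (G.toCombinatorialMap.faceLength (G.ext a))

end CylinderDecomposition

/-- `2n` Majorana modes `c_u`, indexed by `V`, on a Hilbert space `H` of dimension `2 ^ n` (the
Hilbert space of `n` fermionic modes). -/
structure MajoranaModes (V H : Type*) [DecidableEq V] [NormedAddCommGroup H]
    [InnerProductSpace ℂ H] where
  c : V → Module.End ℂ H
  anticomm : ∀ u v, c u * c v + c v * c u = if u = v then 2 else 0
  selfAdjoint : ∀ u, (c u).IsSymmetric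
  dim : ∃ n : ℕ, Nat.card V = 2 * n ∧ Module.finrank ℂ H = 2 ^ n

namespace MajoranaModes

variable {V H : Type*} [LinearOrder V] [NormedAddCommGroup H] [InnerProductSpace ℂ H]

theorem c_mul_self (M : MajoranaModes V H) (u : V) : M.c u * M.c u = 1 := by
  have h := M.anticomm u u
  rw [if_pos rfl, ← two_mul] at h
  have h2 : (2 : ℂ) • (M.c u * M.c u) = (2 : ℂ) • (1 : Module.End ℂ H) := by
    rw [two_smul, two_smul, ← two_mul, h, one_add_one_eq_two]
  exact smul_right_injective _ (two_ne_zero : (2 : ℂ) ≠ 0) h2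

/-- The operator `c_u` as an invertible operator. -/
def mode (M : MajoranaModes V H) (u : V) : (Module.End ℂ H)ˣ :=
  ⟨M.c u, M.c u, M.c_mul_self u, M.c_mul_self u⟩

/-- The scalar operator `η I`. -/
def scalar (H : Type*) [NormedAddCommGroup H] [InnerProductSpace ℂ H] (η : ℂˣ) :
    (Module.End ℂ H)ˣ :=
  Units.map (algebraMap ℂ (Module.End ℂ H)).toMonoidHom η

/-- The phase factor `i`. -/
noncomputable def iUnit : ℂˣ := Units.mk0 Complex.I Complex.I_ne_zero

/-- `c_A`, the product of the `c_u`, `u ∈ A`, with increasing indices from left to right. -/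
def op (M : MajoranaModes V H) (A : Finset V) : (Module.End ℂ H)ˣ :=
  ((A.sort (· ≤ ·)).map M.mode).prod

/-- The group of Majorana operators, generated by the modes and the phase factor `i`. -/
def majoranaGroup (M : MajoranaModes V H) : Subgroup (Module.End ℂ H)ˣ :=
  Subgroup.closure (Set.range M.mode ∪ {scalar H iUnit})

/-- `P = η c_A` for a phase factor `η ∈ {1, -1, i, -i}`. -/
def HasSupport (M : MajoranaModes V H) (P : (Module.End ℂ H)ˣ) (A : Finset V) : Prop :=
  ∃ η ∈ rootsOfUnity 4 ℂ, P = scalar H η * M.op A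

/-- `S` is the stabilizer group of a Majorana fermion code: an abelian group of Majorana operators
of even weight that does not contain `-I`. -/
structure IsCode (M : MajoranaModes V H) (S : Subgroup (Module.End ℂ H)ˣ) : Prop where
  le_majoranaGroup : S ≤ M.majoranaGroup
  comm : ∀ P ∈ S, ∀ Q ∈ S, P * Q = Q * P
  neg_one_notMem : -1 ∉ S
  even : ∀ P ∈ S, ∀ A, M.HasSupport P A → Even A.card

/-- The code with stabilizer group `S` on `2n` modes encodes `k` logical qubits: `S` is generated
by `n - k` independent generators. -/
def EncodesQubits (_M : MajoranaModes V H) (S : Subgroup (Module.End ℂ H)ˣ) (k : ℕ) : Prop :=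
  ∃ (m : ℕ) (g : Fin m → (Module.End ℂ H)ˣ), Nat.card V = 2 * (m + k) ∧
    Subgroup.closure (Set.range g) = S ∧
    ∀ j, g j ∉ Subgroup.closure (g '' {j}ᶜ)

/-- The codespace: the vectors invariant under `S`. -/
def codespace (_M : MajoranaModes V H) (S : Subgroup (Module.End ℂ H)ˣ) : Submodule ℂ H where
  carrier := {ψ | ∀ P ∈ S, (P : Module.End ℂ H) ψ = ψ}
  add_mem' hx hy P hP := by rw [map_add, hx P hP, hy P hP]
  zero_mem' P _ := map_zero _
  smul_mem' a x hx P hP := by rw [map_smul, hx P hP]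

/-- The centralizer of `S` in the group of Majorana operators. -/
def centralizer (M : MajoranaModes V H) (S : Subgroup (Module.End ℂ H)ˣ) :
    Subgroup (Module.End ℂ H)ˣ :=
  M.majoranaGroup ⊓ Subgroup.centralizer (S : Set (Module.End ℂ H)ˣ)

/-- A logical operator: an element of the centralizer of `S` that is not in `S`. -/
def IsLogical (M : MajoranaModes V H) (S : Subgroup (Module.End ℂ H)ˣ)
    (P : (Module.End ℂ H)ˣ) : Prop :=
  P ∈ M.centralizer S ∧ P ∉ S

/-- `X`, `Y`, `Z` are the logical Pauli operators of a code with one logical qubit: logical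
operators with the relations of the Pauli matrices which together with `S` and `i` generate the
centralizer of `S`. -/
structure IsLogicalPauli (M : MajoranaModes V H) (S : Subgroup (Module.End ℂ H)ˣ)
    (X Y Z : (Module.End ℂ H)ˣ) : Prop where
  isLogical : M.IsLogical S X ∧ M.IsLogical S Y ∧ M.IsLogical S Z
  selfAdjoint : (X : Module.End ℂ H).IsSymmetric ∧ (Y : Module.End ℂ H).IsSymmetric ∧
    (Z : Module.End ℂ H).IsSymmetric
  sq : X * X = 1 ∧ Y * Y = 1 ∧ Z * Z = 1
  anticomm : X * Y = -(Y * X) ∧ Y * Z = -(Z * Y) ∧ Z * X = -(X * Z)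
  mul_eq : X * Y = scalar H iUnit * Z
  centralizer_eq : M.centralizer S =
    Subgroup.closure ({scalar H iUnit} ∪ (S : Set (Module.End ℂ H)ˣ) ∪ {X, Y, Z})

end MajoranaModes

namespace CylinderDecomposition

variable {D : Type*} [Finite D] (G : CylinderDecomposition D) [LinearOrder G.Vertex]
  {H : Type*} [NormedAddCommGroup H] [InnerProductSpace ℂ H]

/-- The face operator `C_f`. -/
noncomputable def faceOperator (M : MajoranaModes G.Vertex H) (f : G.Face) : (Module.End ℂ H)ˣ :=
  M.op (G.faceVertices f)

/-- The boundary operator `C̄_a`, the product of the modes on the boundary circle `S¹ × {a}`. -/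
noncomputable def boundaryOperator (M : MajoranaModes G.Vertex H) (a : Fin 2) :
    (Module.End ℂ H)ˣ :=
  M.op (G.boundaryVertices a)

/-- `S` is the stabilizer group of a Majorana color code of `G`: it is generated by face operators
with phase factors chosen such that it is abelian and does not contain `-I`. -/
def IsColorCode (M : MajoranaModes G.Vertex H) (S : Subgroup (Module.End ℂ H)ˣ) : Prop :=
  (∃ η : G.Face → rootsOfUnity 4 ℂ,
    S = Subgroup.closure
      (Set.range fun f => MajoranaModes.scalar H (η f : ℂˣ) * G.faceOperator M f)) ∧
  (∀ P ∈ S, ∀ Q ∈ S, P * Q = Q * P) ∧ -1 ∉ S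

end CylinderDecomposition

/-!
The theorem is reduced to linear algebra over `𝔽₂`. A product `c_A` of Majorana modes is described by
the indicator vector of `A` in `𝔽₂^V`: products of operators correspond to sums of vectors
(`op_mul_op`), and operators of even weight commute exactly if their vectors are orthogonal
(`op_mul_op_comm`). As the number of modes is even, a Majorana operator determines its vector and is
traceless unless it is a scalar. So a commuting group `S` of Majorana operators without `-1` is
isomorphic to a subspace `W` of `𝔽₂^V` (`HasSupportSpace`). A basis of `W` gives independent generators
of `S`, the trace of the projector onto the codespace gives its dimension `2 ^ n / |W|`, and the
centralizer of `S` consists, up to phase factors, of the `c_A` with `A` in the orthogonal complement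
of `W`.

For the graph, `W` is spanned by the boundaries of the faces of the cylinder. Faces commute with each
other and with the boundary circles since two distinct faces of a trivalent map have an even number of
common vertices (`even_card_inter`). It remains to see that `dim W = n - 1` and that the orthogonal
complement of `W` is spanned by `W` and the two boundary circles (`finrank_faceSpan`). This follows by
counting dimensions from two facts on the sphere that arises by patching the holes of the cylinder:

* There are at least `n + 2` faces, by the Euler characteristic. Simple connectivity enters as the
  vanishing of the first cohomology over `𝔽₂` (`exists_coboundary`, `card_darts_add_four_le`).
* There is at most one nontrivial relation between the faces. The values of a relation at one vertex
  determine it everywhere, as they can be transported along the edges, and transport around a face of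
  odd length forces the value on this face to be `0` (`relation_eq_zero`).

Indeed, the faces of the sphere then span a subspace `U` of dimension at least `n + 1` that is orthogonal
to `W`, while `dim U ≤ dim W + 2` and the orthogonal complement of `W` has dimension `2 n - dim W`.

The boundary circles are disjoint and of odd weight, so their operators anticommute; this makes them
two of the logical Pauli operators.
-/

/-! ### Products of Majorana modes -/

namespace MajoranaModes

variable {V H : Type*} [LinearOrder V] [NormedAddCommGroup H] [InnerProductSpace ℂ H]
  (M : MajoranaModes V H)

theorem mode_mul_self (u : V) : M.mode u * M.mode u = 1 :=
  Units.ext (M.c_mul_self u)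

theorem mode_mul_mode {u v : V} (h : u ≠ v) : M.mode u * M.mode v = -(M.mode v * M.mode u) := by
  have := M.anticomm u v
  rw [if_neg h] at this
  exact Units.ext (eq_neg_of_add_eq_zero_left this)

theorem prod_mode_perm {l₁ l₂ : List V} (h : l₁.Perm l₂) :
    (l₁.map M.mode).prod = (l₂.map M.mode).prod ∨
      (l₁.map M.mode).prod = -(l₂.map M.mode).prod := by
  induction h with
  | nil => simp
  | cons x _ ih => rcases ih with h | h <;> simp [h]
  | swap x y l =>
    by_cases hxy : y = x
    · simp [hxy]
    · right
      simp [← mul_assoc, M.mode_mul_mode hxy]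
  | trans _ _ h₁ h₂ => rcases h₁ with h₁ | h₁ <;> rcases h₂ with h₂ | h₂ <;> simp [h₁, h₂]

theorem mode_mul_op (u : V) (A : Finset V) :
    M.mode u * M.op A = M.op (symmDiff {u} A) ∨ M.mode u * M.op A = -M.op (symmDiff {u} A) := by
  by_cases hu : u ∈ A
  · have hs : symmDiff {u} A = A.erase u := by ext x; simp [Finset.mem_symmDiff]; grind
    have hp : (A.sort (· ≤ ·)).Perm (u :: (A.erase u).sort (· ≤ ·)) := by
      rw [List.perm_ext_iff_of_nodup] <;> simp; grind
    rw [hs]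
    rcases M.prod_mode_perm hp with h | h <;> simp only [op, h] <;>
      simp [← mul_assoc, M.mode_mul_self]
  · have hs : symmDiff {u} A = insert u A := by ext x; simp [Finset.mem_symmDiff]; grind
    have hp : (u :: A.sort (· ≤ ·)).Perm ((insert u A).sort (· ≤ ·)) := by
      rw [List.perm_ext_iff_of_nodup] <;> simp [hu]
    rw [hs]
    simpa [op] using M.prod_mode_perm hp

@[simp] theorem op_empty : M.op ∅ = 1 := by simp [op]

/-- Up to a sign, products of modes multiply like symmetric differences. -/
theorem op_mul_op (A B : Finset V) :
    M.op A * M.op B = M.op (symmDiff A B) ∨ M.op A * M.op B = -M.op (symmDiff A B) := by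
  have key : ∀ l : List V, l.Nodup →
      (l.map M.mode).prod * M.op B = M.op (symmDiff l.toFinset B) ∨
        (l.map M.mode).prod * M.op B = -M.op (symmDiff l.toFinset B) := by
    intro l hl
    induction l with
    | nil => left; simp [symmDiff_def]
    | cons u l ih =>
      rw [List.nodup_cons] at hl
      have hs : symmDiff (u :: l).toFinset B = symmDiff {u} (symmDiff l.toFinset B) := by
        ext x
        have := hl.1
        simp only [Finset.mem_symmDiff, List.toFinset_cons, Finset.mem_insert,
          List.mem_toFinset, Finset.mem_singleton]
        grind
      rw [hs, List.map_cons, List.prod_cons, mul_assoc]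
      rcases ih hl.2 with h | h <;> rw [h] <;>
        rcases M.mode_mul_op u (symmDiff l.toFinset B) with h' | h' <;> simp [h']
  simpa [op] using key (A.sort (· ≤ ·)) (Finset.sort_nodup _ _)

theorem mode_mul_prod_mode (u : V) (l : List V) :
    M.mode u * (l.map M.mode).prod =
      (-1) ^ (l.length + l.count u) * ((l.map M.mode).prod * M.mode u) := by
  induction l with
  | nil => simp
  | cons v l ih =>
    rw [List.map_cons, List.prod_cons, ← mul_assoc]
    by_cases h : u = v
    · subst h
      have : (u :: l).length + (u :: l).count u = l.length + l.count u + 2 := by simp; ring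
      rw [this, pow_add _ (_ + _) 2, neg_one_sq, mul_one]
      rcases neg_one_pow_eq_or (Module.End ℂ H)ˣ (l.length + l.count u) with h | h <;>
        rw [h] at ih ⊢ <;> simp only [one_mul, neg_one_mul] at ih ⊢ <;>
        rw [M.mode_mul_self, ih] <;> simp [mul_assoc, M.mode_mul_self]
    · rw [M.mode_mul_mode h, neg_mul, mul_assoc, ih, List.length_cons, List.count_cons_of_ne
        (Ne.symm h), add_right_comm, pow_succ]
      rcases neg_one_pow_eq_or (Module.End ℂ H)ˣ (l.length + l.count u) with h | h <;>
        simp [h, mul_assoc]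

theorem prod_mode_mul_prod_mode (l₁ l₂ : List V) :
    (l₁.map M.mode).prod * (l₂.map M.mode).prod =
      (-1) ^ (l₁.length * l₂.length + (l₁.map fun u => l₂.count u).sum) *
        ((l₂.map M.mode).prod * (l₁.map M.mode).prod) := by
  induction l₁ with
  | nil => simp
  | cons u l ih =>
    have he : (u :: l).length * l₂.length + ((u :: l).map fun u => l₂.count u).sum =
        (l.length * l₂.length + (l.map fun u => l₂.count u).sum) +
          (l₂.length + l₂.count u) := by simp; ring
    rw [he, pow_add, List.map_cons, List.prod_cons, mul_assoc, ih]
    have h1 := M.mode_mul_prod_mode u l₂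
    rcases neg_one_pow_eq_or (Module.End ℂ H)ˣ
      (l.length * l₂.length + (l.map fun u => l₂.count u).sum) with h | h <;>
    rcases neg_one_pow_eq_or (Module.End ℂ H)ˣ (l₂.length + l₂.count u) with h' | h' <;>
    simp [h, h', ← mul_assoc] at h1 ⊢ <;> simp [h1]

/-- Two products of modes commute up to the sign `(-1) ^ (|A| |B| - |A ∩ B|)`. -/
theorem op_mul_op_comm (A B : Finset V) :
    M.op A * M.op B = (-1) ^ (A.card * B.card + (A ∩ B).card) * (M.op B * M.op A) := by
  have h := M.prod_mode_mul_prod_mode (A.sort (· ≤ ·)) (B.sort (· ≤ ·))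
  have h2 : ((A.sort (· ≤ ·)).map fun u => (B.sort (· ≤ ·)).count u).sum = (A ∩ B).card := by
    have h3 : ∀ u, (B.sort (· ≤ ·)).count u = if u ∈ B then 1 else 0 := fun u => by
      rw [List.Nodup.count (Finset.sort_nodup _ _)]; simp
    rw [← List.sum_toFinset _ (Finset.sort_nodup _ _)]
    simp [h3, Finset.inter_comm A B]
  rw [h2] at h
  simpa [op] using h

/-! ### Phase factors -/

theorem scalar_comm (η : ℂˣ) (P : (Module.End ℂ H)ˣ) : scalar H η * P = P * scalar H η :=
  Units.ext (Algebra.commutes _ _)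

theorem coe_scalar (η : ℂˣ) : (scalar H η : Module.End ℂ H) = algebraMap ℂ _ (η : ℂ) := rfl

theorem scalar_mul (η ζ : ℂˣ) : scalar H (η * ζ) = scalar H η * scalar H ζ := map_mul _ _ _

theorem scalar_one : scalar H 1 = 1 := map_one _

theorem scalar_neg (η : ℂˣ) : scalar H (-η) = -scalar H η :=
  Units.ext (by simp [coe_scalar])

theorem scalar_neg_one : scalar H (-1) = -1 := by rw [scalar_neg, scalar_one]

theorem iUnit_sq : iUnit ^ 2 = -1 := Units.ext (by simp [iUnit])

theorem iUnit_mem : iUnit ∈ rootsOfUnity 4 ℂ := by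
  rw [mem_rootsOfUnity]
  rw [show (4 : ℕ) = 2 * 2 from rfl, pow_mul, iUnit_sq, neg_one_sq]

theorem neg_one_mem : (-1 : ℂˣ) ∈ rootsOfUnity 4 ℂ := by
  rw [mem_rootsOfUnity]
  exact (show Even 4 by decide).neg_one_pow

theorem phase_sq {η : ℂˣ} (h : η ∈ rootsOfUnity 4 ℂ) : η ^ 2 = 1 ∨ η ^ 2 = -1 := by
  rw [mem_rootsOfUnity, show (4 : ℕ) = 2 * 2 from rfl, pow_mul] at h
  have h2 : ((η ^ 2 : ℂˣ) : ℂ) ^ 2 = 1 := by rw [← Units.val_pow_eq_pow_val, h, Units.val_one]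
  rcases sq_eq_one_iff.1 h2 with h3 | h3
  · exact Or.inl (Units.ext h3)
  · exact Or.inr (Units.ext h3)

end MajoranaModes

/-! ### Supports of Majorana operators -/

/-- The indicator vector over `𝔽₂` of a finite set. -/
def indicatorVec {V : Type*} [DecidableEq V] (A : Finset V) : V → ZMod 2 :=
  fun v => if v ∈ A then 1 else 0

section indicatorVec

variable {V : Type*} [DecidableEq V]

theorem indicatorVec_injective : Function.Injective (indicatorVec : Finset V → V → ZMod 2) := by
  intro A B h
  ext v
  have := congrFun h v
  simp only [indicatorVec] at this
  by_cases hA : v ∈ A <;> by_cases hB : v ∈ B <;> simp_all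

theorem indicatorVec_symmDiff (A B : Finset V) :
    indicatorVec (symmDiff A B) = indicatorVec A + indicatorVec B := by
  funext v
  by_cases hA : v ∈ A <;> by_cases hB : v ∈ B <;>
    simp [indicatorVec, Finset.mem_symmDiff, hA, hB]
  decide

theorem indicatorVec_empty : indicatorVec (∅ : Finset V) = 0 := by
  funext v; simp [indicatorVec]

variable [Fintype V]

theorem dotProduct_indicatorVec (A B : Finset V) :
    indicatorVec A ⬝ᵥ indicatorVec B = ((A ∩ B).card : ZMod 2) := by
  simp [indicatorVec, dotProduct, ← ite_and, Finset.sum_boole]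
  congr 2; ext; simp [and_comm]

theorem sum_indicatorVec (A : Finset V) : ∑ v, indicatorVec A v = (A.card : ZMod 2) := by
  simp [indicatorVec]

end indicatorVec

namespace MajoranaModes

variable {V H : Type*} [LinearOrder V] [NormedAddCommGroup H] [InnerProductSpace ℂ H]
  (M : MajoranaModes V H)

theorem finiteDimensional (M : MajoranaModes V H) : FiniteDimensional ℂ H := by
  obtain ⟨n, -, h⟩ := M.dim
  exact Module.finite_of_finrank_pos (by rw [h]; positivity)

theorem nontrivial (M : MajoranaModes V H) : Nontrivial H := by
  obtain ⟨n, -, h⟩ := M.dim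
  exact Module.nontrivial_of_finrank_pos (R := ℂ) (by rw [h]; positivity)

theorem neg_ne_self (M : MajoranaModes V H) (P : (Module.End ℂ H)ˣ) : -P ≠ P := by
  have := M.nontrivial
  intro h
  have h1 : (-1 : (Module.End ℂ H)ˣ) = 1 := by
    have := congrArg (· * P⁻¹) h
    simpa using this
  have h2 : (-1 : Module.End ℂ H) = 1 := congrArg Units.val h1
  obtain ⟨x, hx⟩ := exists_ne (0 : H)
  have h3 : -x = x := by simpa using congrArg (fun f : Module.End ℂ H => f x) h2
  have h4 : (2 : ℂ) • x = 0 := by rw [two_smul]; nth_rewrite 1 [← h3]; simp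
  exact hx ((smul_eq_zero.1 h4).resolve_left two_ne_zero)

theorem op_commute_of_even {A B : Finset V} (h : Even (A.card * B.card + (A ∩ B).card)) :
    M.op A * M.op B = M.op B * M.op A := by
  rw [M.op_mul_op_comm, h.neg_one_pow, one_mul]

theorem op_anticommute_of_odd {A B : Finset V} (h : Odd (A.card * B.card + (A ∩ B).card)) :
    M.op A * M.op B = -(M.op B * M.op A) := by
  rw [M.op_mul_op_comm, h.neg_one_pow, neg_one_mul]

variable {M}

theorem hasSupport_op (A : Finset V) : M.HasSupport (M.op A) A :=
  ⟨1, one_mem _, by rw [scalar_one, one_mul]⟩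

theorem hasSupport_scalar {η : ℂˣ} (hη : η ∈ rootsOfUnity 4 ℂ) : M.HasSupport (scalar H η) ∅ :=
  ⟨η, hη, by simp⟩

theorem hasSupport_one : M.HasSupport 1 ∅ := by
  simpa using M.hasSupport_op ∅

theorem HasSupport.mul {P Q : (Module.End ℂ H)ˣ} {A B : Finset V} (hP : M.HasSupport P A)
    (hQ : M.HasSupport Q B) : M.HasSupport (P * Q) (symmDiff A B) := by
  obtain ⟨η, hη, rfl⟩ := hP
  obtain ⟨ζ, hζ, rfl⟩ := hQ
  have h : scalar H η * M.op A * (scalar H ζ * M.op B) =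
      scalar H (η * ζ) * (M.op A * M.op B) := by
    rw [scalar_mul, mul_assoc, ← mul_assoc (M.op A), ← scalar_comm, mul_assoc, mul_assoc]
  rw [h]
  rcases M.op_mul_op A B with h | h
  · exact ⟨_, mul_mem hη hζ, by rw [h]⟩
  · exact ⟨-1 * (η * ζ), mul_mem neg_one_mem (mul_mem hη hζ), by
      rw [h, scalar_mul (-1), scalar_neg_one]; simp⟩

theorem HasSupport.smul {P : (Module.End ℂ H)ˣ} {A : Finset V} (hP : M.HasSupport P A)
    {η : ℂˣ} (hη : η ∈ rootsOfUnity 4 ℂ) : M.HasSupport (scalar H η * P) A := by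
  have := (hasSupport_scalar (M := M) hη).mul hP
  simpa [symmDiff_def] using this

theorem HasSupport.neg {P : (Module.End ℂ H)ˣ} {A : Finset V} (hP : M.HasSupport P A) :
    M.HasSupport (-P) A := by
  have := hP.smul neg_one_mem
  rwa [scalar_neg_one, neg_one_mul] at this

/-- Squares of Majorana operators are `±1`. -/
theorem HasSupport.mul_self {P : (Module.End ℂ H)ˣ} {A : Finset V} (hP : M.HasSupport P A) :
    P * P = 1 ∨ P * P = -1 := by
  obtain ⟨η, hη, rfl⟩ := hP
  have h : scalar H η * M.op A * (scalar H η * M.op A) =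
      scalar H (η ^ 2) * (M.op A * M.op A) := by
    rw [sq, scalar_mul, mul_assoc, ← mul_assoc (M.op A), ← scalar_comm, mul_assoc, mul_assoc]
  rw [h]
  have h2 := M.op_mul_op A A
  rw [symmDiff_self, Finset.bot_eq_empty, op_empty] at h2
  rcases phase_sq hη with h1 | h1 <;> rcases h2 with h2 | h2 <;>
    simp [h1, h2, scalar_one, scalar_neg_one]

theorem HasSupport.inv {P : (Module.End ℂ H)ˣ} {A : Finset V} (hP : M.HasSupport P A) :
    M.HasSupport P⁻¹ A := by
  rcases hP.mul_self with h | h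
  · rwa [inv_eq_of_mul_eq_one_left h]
  · have h' : -P * P = 1 := by rw [neg_mul, h, neg_neg]
    rw [inv_eq_of_mul_eq_one_left h']
    exact hP.neg

/-- A phase factor makes a product of modes an involution. -/
theorem exists_phase_mul_self (M : MajoranaModes V H) (A : Finset V) :
    ∃ η : rootsOfUnity 4 ℂ,
      scalar H (η : ℂˣ) * M.op A * (scalar H (η : ℂˣ) * M.op A) = 1 := by
  rcases (hasSupport_op (M := M) A).mul_self with h | h
  · exact ⟨1, by simpa [scalar_one] using h⟩
  · refine ⟨⟨iUnit, iUnit_mem⟩, ?_⟩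
    rw [mul_assoc, ← mul_assoc (M.op A), ← scalar_comm, mul_assoc, h, ← mul_assoc, ← scalar_mul,
      ← sq, iUnit_sq, scalar_neg_one]
    simp

theorem HasSupport.commute {P Q : (Module.End ℂ H)ˣ} {A B : Finset V} (hP : M.HasSupport P A)
    (hQ : M.HasSupport Q B) (h : Even (A.card * B.card + (A ∩ B).card)) : P * Q = Q * P := by
  obtain ⟨η, hη, rfl⟩ := hP
  obtain ⟨ζ, hζ, rfl⟩ := hQ
  have hc : Commute (M.op A) (M.op B) := M.op_commute_of_even h
  have h1 : ∀ (η : ℂˣ) (P : (Module.End ℂ H)ˣ), Commute (scalar H η) P := scalar_comm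
  exact ((h1 _ _).mul_left ((h1 _ _).symm.mul_right hc)).eq

theorem HasSupport.anticommute {P Q : (Module.End ℂ H)ˣ} {A B : Finset V}
    (hP : M.HasSupport P A) (hQ : M.HasSupport Q B)
    (h : Odd (A.card * B.card + (A ∩ B).card)) : P * Q = -(Q * P) := by
  obtain ⟨η, hη, rfl⟩ := hP
  obtain ⟨ζ, hζ, rfl⟩ := hQ
  have hc := M.op_anticommute_of_odd h
  rw [mul_assoc, ← mul_assoc (M.op A), ← scalar_comm, mul_assoc, hc, mul_assoc (scalar H ζ),
    ← mul_assoc (M.op B), ← scalar_comm, mul_neg, mul_neg, mul_assoc, ← mul_assoc (scalar H η),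
    ← mul_assoc (scalar H ζ), scalar_comm η]

theorem HasSupport.even_of_commute {P Q : (Module.End ℂ H)ˣ} {A B : Finset V}
    (hP : M.HasSupport P A) (hQ : M.HasSupport Q B) (h : P * Q = Q * P) :
    Even (A.card * B.card + (A ∩ B).card) := by
  by_contra hodd
  have := hP.anticommute hQ (Nat.not_even_iff_odd.1 hodd)
  exact M.neg_ne_self (Q * P) (this.symm.trans h)

theorem even_card (M : MajoranaModes V H) [Fintype V] : Even (Fintype.card V) := by
  obtain ⟨n, h, -⟩ := M.dim
  rw [← Nat.card_eq_fintype_card, h]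
  exact even_two_mul n

/-- A nonempty product of modes anticommutes with some mode: if `|A|` is even, with those in `A`,
otherwise with those outside `A`. Here it matters that the number of modes is even, so that `A` is
not the set of all modes in the second case. -/
theorem exists_anticommute [Fintype V] {A : Finset V} (hA : A.Nonempty) :
    ∃ u, M.op {u} * M.op A = -(M.op A * M.op {u}) := by
  have hex : ∃ u : V, Odd (A.card + (({u} : Finset V) ∩ A).card) := by
    rcases Nat.even_or_odd A.card with h | h
    · obtain ⟨u, hu⟩ := hA
      refine ⟨u, ?_⟩
      rw [Finset.singleton_inter_of_mem hu, Finset.card_singleton]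
      exact h.add_one
    · have : A ≠ Finset.univ := by
        rintro rfl
        rw [Finset.card_univ] at h
        exact (Nat.not_even_iff_odd.2 h) M.even_card
      obtain ⟨u, hu⟩ : ∃ u, u ∉ A := by
        by_contra! h; exact this (Finset.eq_univ_of_forall h)
      refine ⟨u, ?_⟩
      rwa [Finset.singleton_inter_of_notMem hu, Finset.card_empty, add_zero]
  obtain ⟨u, hu⟩ := hex
  exact ⟨u, M.op_anticommute_of_odd (by simpa using hu)⟩

/-- A scalar does not have a nonempty support, since it commutes with all modes. -/
theorem HasSupport.eq_empty_of_scalar [Fintype V] {η : ℂˣ} {A : Finset V}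
    (h : M.HasSupport (scalar H η) A) : A = ∅ := by
  by_contra hA
  obtain ⟨u, hu⟩ := exists_anticommute (M := M) (Finset.nonempty_of_ne_empty hA)
  obtain ⟨ζ, -, h⟩ := h
  have h1 : M.op A = scalar H (ζ⁻¹ * η) := by
    rw [scalar_mul, h, ← mul_assoc, ← scalar_mul]; simp [scalar_one]
  rw [h1, ← scalar_comm] at hu
  exact M.neg_ne_self _ hu.symm

/-- The support of a Majorana operator is unique. -/
theorem HasSupport.unique [Fintype V] {P : (Module.End ℂ H)ˣ} {A B : Finset V}
    (hA : M.HasSupport P A) (hB : M.HasSupport P B) : A = B := by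
  have h := hA.mul hB.inv
  rw [mul_inv_cancel, ← scalar_one] at h
  exact symmDiff_eq_bot.1 h.eq_empty_of_scalar

theorem HasSupport.eq_scalar {P : (Module.End ℂ H)ˣ} (h : M.HasSupport P ∅) :
    ∃ η ∈ rootsOfUnity 4 ℂ, P = scalar H η := by
  obtain ⟨η, hη, h⟩ := h
  exact ⟨η, hη, by simpa using h⟩

theorem HasSupport.trace_eq_zero [Fintype V] {P : (Module.End ℂ H)ˣ} {A : Finset V}
    (h : M.HasSupport P A) (hA : A.Nonempty) :
    LinearMap.trace ℂ H (P : Module.End ℂ H) = 0 := by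
  obtain ⟨u, hu⟩ := exists_anticommute (M := M) hA
  obtain ⟨η, -, rfl⟩ := h
  have h1 : M.op {u} * (scalar H η * M.op A) = -(scalar H η * M.op A * M.op {u}) := by
    rw [← mul_assoc, ← scalar_comm, mul_assoc, hu, mul_neg, mul_assoc]
  -- conjugation by the anticommuting mode changes the sign of the trace
  have h2 : M.op {u} * (scalar H η * M.op A) * (M.op {u})⁻¹ = -(scalar H η * M.op A) := by
    rw [h1]; simp
  have h3 := congrArg (fun Q : (Module.End ℂ H)ˣ => LinearMap.trace ℂ H (Q : Module.End ℂ H)) h2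
  simp only [Units.val_mul (_ * _) (_⁻¹), Units.val_neg, map_neg] at h3
  rw [LinearMap.trace_mul_comm, ← Units.val_mul, ← mul_assoc, inv_mul_cancel, one_mul] at h3
  exact self_eq_neg.1 h3

theorem rootsOfUnity_scalar_mem {η : ℂˣ} (hη : η ∈ rootsOfUnity 4 ℂ) :
    scalar H η ∈ Subgroup.closure {scalar H iUnit} := by
  have hi : scalar H iUnit ∈ Subgroup.closure {scalar H iUnit} :=
    Subgroup.subset_closure (Set.mem_singleton _)
  have hm : scalar H (-1) ∈ Subgroup.closure {scalar H iUnit} := by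
    rw [← iUnit_sq, sq, scalar_mul]; exact mul_mem hi hi
  have hsq : ∀ {η : ℂˣ}, η ^ 2 = 1 → η = 1 ∨ η = -1 := fun {η} h => by
    have h' : (η : ℂ) ^ 2 = 1 := by rw [← Units.val_pow_eq_pow_val, h, Units.val_one]
    rcases sq_eq_one_iff.1 h' with h | h
    · exact Or.inl (Units.ext h)
    · exact Or.inr (Units.ext h)
  have h1 : ∀ {η : ℂˣ}, η ^ 2 = 1 → scalar H η ∈ Subgroup.closure {scalar H iUnit} :=
    fun {η} h => by
      rcases hsq h with rfl | rfl
      · rw [scalar_one]; exact one_mem _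
      · exact hm
  rcases phase_sq hη with h | h
  · exact h1 h
  · have : η = iUnit * (iUnit⁻¹ * η) := by simp
    rw [this, scalar_mul]
    exact mul_mem hi (h1 (by rw [mul_pow, inv_pow, h, iUnit_sq]; simp))

theorem mem_majoranaGroup {P : (Module.End ℂ H)ˣ} :
    P ∈ M.majoranaGroup ↔ ∃ A, M.HasSupport P A := by
  constructor
  · intro h
    induction h using Subgroup.closure_induction with
    | mem x hx =>
      rcases hx with ⟨u, rfl⟩ | hx
      · exact ⟨{u}, by simpa [op] using hasSupport_op (M := M) {u}⟩
      · rw [Set.mem_singleton_iff.1 hx]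
        exact ⟨∅, hasSupport_scalar iUnit_mem⟩
    | one => exact ⟨∅, hasSupport_one⟩
    | mul x y _ _ hx hy =>
      obtain ⟨A, hA⟩ := hx
      obtain ⟨B, hB⟩ := hy
      exact ⟨_, hA.mul hB⟩
    | inv x _ hx =>
      obtain ⟨A, hA⟩ := hx
      exact ⟨A, hA.inv⟩
  · rintro ⟨A, η, hη, rfl⟩
    refine mul_mem (Subgroup.closure_mono Set.subset_union_right (rootsOfUnity_scalar_mem hη)) ?_
    refine list_prod_mem fun x hx => ?_
    obtain ⟨u, -, rfl⟩ := List.mem_map.1 hx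
    exact Subgroup.subset_closure (Or.inl ⟨u, rfl⟩)

theorem HasSupport.mem_majoranaGroup {P : (Module.End ℂ H)ˣ} {A : Finset V}
    (h : M.HasSupport P A) : P ∈ M.majoranaGroup := MajoranaModes.mem_majoranaGroup.2 ⟨A, h⟩

/-- Majorana operators are unitary. -/
theorem inner_map_map {P : (Module.End ℂ H)ˣ} (hP : P ∈ M.majoranaGroup) (x y : H) :
    inner ℂ ((P : Module.End ℂ H) x) ((P : Module.End ℂ H) y) = inner ℂ x y := by
  induction hP using Subgroup.closure_induction generalizing x y with
  | mem P hP =>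
    rcases hP with ⟨u, rfl⟩ | hP
    · have h1 : M.c u (M.c u y) = y := by
        simpa using congrArg (fun f : Module.End ℂ H => f y) (M.c_mul_self u)
      change inner ℂ (M.c u x) (M.c u y) = _
      rw [M.selfAdjoint u x, h1]
    · rw [Set.mem_singleton_iff.1 hP, coe_scalar, Module.algebraMap_end_apply,
        Module.algebraMap_end_apply, inner_smul_left, inner_smul_right]
      simp [iUnit, ← mul_assoc]
  | one => rfl
  | mul P Q _ _ hP hQ => simp [hP, hQ]
  | inv P _ hP =>
    rw [← hP]
    simp [← Module.End.mul_apply]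

theorem isSymmetric_of_mul_self {P : (Module.End ℂ H)ˣ} (hP : P ∈ M.majoranaGroup)
    (h : P * P = 1) : (P : Module.End ℂ H).IsSymmetric := by
  intro x y
  have h1 : (P : Module.End ℂ H) ((P : Module.End ℂ H) y) = y := by
    rw [← Module.End.mul_apply, ← Units.val_mul, h]; rfl
  rw [← inner_map_map hP x, h1]

end MajoranaModes

/-! ### Stabilizer groups and their support spaces -/

namespace MajoranaModes

variable {V H : Type*} [LinearOrder V] [NormedAddCommGroup H] [InnerProductSpace ℂ H]
  {M : MajoranaModes V H}

/-- The subgroup `S` of Majorana operators is mapped isomorphically onto the subspace `W` of `𝔽₂^V`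
by taking supports. -/
structure HasSupportSpace (M : MajoranaModes V H) (S : Subgroup (Module.End ℂ H)ˣ)
    (W : Submodule (ZMod 2) (V → ZMod 2)) : Prop where
  exists_support : ∀ P ∈ S, ∃ A, M.HasSupport P A ∧ indicatorVec A ∈ W
  exists_mem : ∀ w ∈ W, ∃ P ∈ S, ∃ A, M.HasSupport P A ∧ indicatorVec A = w
  eq_one : ∀ P ∈ S, M.HasSupport P ∅ → P = 1

/-- If `-1 ∉ S`, then `S` contains no phase factor besides `1`. -/
theorem eq_one_of_neg_one_notMem {S : Subgroup (Module.End ℂ H)ˣ} (hS : -1 ∉ S)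
    {P : (Module.End ℂ H)ˣ} (hP : P ∈ S) (h : M.HasSupport P ∅) : P = 1 := by
  rcases h.mul_self with h1 | h1
  · obtain ⟨η, hη, rfl⟩ := h.eq_scalar
    have := M.nontrivial
    have h2 : (η : ℂ) ^ 2 = 1 := by
      have h3 : algebraMap ℂ (Module.End ℂ H) ((η : ℂ) ^ 2) = algebraMap ℂ _ 1 := by
        have := congrArg Units.val h1
        rw [Units.val_mul, coe_scalar, ← map_mul] at this
        rw [sq, this, map_one]; rfl
      exact FaithfulSMul.algebraMap_injective ℂ (Module.End ℂ H) h3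
    rcases sq_eq_one_iff.1 h2 with h3 | h3
    · rw [show η = 1 from Units.ext h3, scalar_one]
    · rw [show η = -1 from Units.ext h3, scalar_neg_one] at hP
      exact absurd hP hS
  · exact absurd (h1 ▸ mul_mem hP hP) hS

/-- The supports of the elements of a group are spanned by the supports of its generators. -/
theorem exists_support_of_mem_closure {T : Set (Module.End ℂ H)ˣ} {R : Set (V → ZMod 2)}
    (h : ∀ P ∈ T, ∃ A, M.HasSupport P A ∧ indicatorVec A ∈ R) {P : (Module.End ℂ H)ˣ}
    (hP : P ∈ Subgroup.closure T) :
    ∃ A, M.HasSupport P A ∧ indicatorVec A ∈ Submodule.span (ZMod 2) R := by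
  induction hP using Subgroup.closure_induction with
  | mem x hx =>
    obtain ⟨A, hA, hA'⟩ := h x hx
    exact ⟨A, hA, Submodule.subset_span hA'⟩
  | one => exact ⟨∅, hasSupport_one, by rw [indicatorVec_empty]; exact zero_mem _⟩
  | mul x y _ _ hx hy =>
    obtain ⟨B, hB, hB'⟩ := hx
    obtain ⟨C, hC, hC'⟩ := hy
    exact ⟨_, hB.mul hC, by rw [indicatorVec_symmDiff]; exact add_mem hB' hC'⟩
  | inv x _ hx =>
    obtain ⟨B, hB, hB'⟩ := hx
    exact ⟨B, hB.inv, hB'⟩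

/-- The vectors that are supports of elements of a group form a subspace. -/
theorem exists_mem_of_mem_span {K : Subgroup (Module.End ℂ H)ˣ} {R : Set (V → ZMod 2)}
    (h : ∀ x ∈ R, ∃ P ∈ K, ∃ A, M.HasSupport P A ∧ indicatorVec A = x) {x : V → ZMod 2}
    (hx : x ∈ Submodule.span (ZMod 2) R) :
    ∃ P ∈ K, ∃ A, M.HasSupport P A ∧ indicatorVec A = x := by
  induction hx using Submodule.span_induction with
  | mem x hx => exact h x hx
  | zero => exact ⟨1, one_mem _, ∅, hasSupport_one, indicatorVec_empty⟩
  | add x y _ _ hx hy =>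
    obtain ⟨P, hP, B, hB, rfl⟩ := hx
    obtain ⟨Q, hQ, C, hC, rfl⟩ := hy
    exact ⟨_, mul_mem hP hQ, _, hB.mul hC, indicatorVec_symmDiff _ _⟩
  | smul a x _ hx =>
    have ha : a = 0 ∨ a = 1 := by revert a; decide
    rcases ha with rfl | rfl
    · exact ⟨1, one_mem _, ∅, hasSupport_one, by rw [indicatorVec_empty, zero_smul]⟩
    · simpa using hx

theorem HasSupportSpace.of_closure {ι : Type*} {A : ι → Finset V} {η : ι → rootsOfUnity 4 ℂ}
    {S : Subgroup (Module.End ℂ H)ˣ}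
    (hS : S = Subgroup.closure (Set.range fun i => scalar H (η i : ℂˣ) * M.op (A i)))
    (hneg : -1 ∉ S) :
    M.HasSupportSpace S (Submodule.span (ZMod 2) (Set.range fun i => indicatorVec (A i))) where
  exists_support P hP := by
    rw [hS] at hP
    refine exists_support_of_mem_closure ?_ hP
    rintro _ ⟨i, rfl⟩
    exact ⟨A i, (hasSupport_op (A i)).smul (η i).2, ⟨i, rfl⟩⟩
  exists_mem w hw := by
    refine exists_mem_of_mem_span ?_ hw
    rintro _ ⟨i, rfl⟩
    exact ⟨_, by rw [hS]; exact Subgroup.subset_closure ⟨i, rfl⟩, A i,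
      (hasSupport_op (A i)).smul (η i).2, rfl⟩
  eq_one P hP h := eq_one_of_neg_one_notMem hneg hP h

namespace HasSupportSpace

variable {S : Subgroup (Module.End ℂ H)ˣ} {W : Submodule (ZMod 2) (V → ZMod 2)}

theorem eq_of_support (h : M.HasSupportSpace S W) {P Q : (Module.End ℂ H)ˣ} (hP : P ∈ S)
    (hQ : Q ∈ S) {A : Finset V} (hPA : M.HasSupport P A) (hQA : M.HasSupport Q A) : P = Q := by
  have h1 := hPA.mul hQA.inv
  rw [symmDiff_self, Finset.bot_eq_empty] at h1
  exact mul_inv_eq_one.1 (h.eq_one _ (mul_mem hP (inv_mem hQ)) h1)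

variable [Fintype V]

theorem indicatorVec_mem (h : M.HasSupportSpace S W) {P : (Module.End ℂ H)ˣ} (hP : P ∈ S)
    {A : Finset V} (hA : M.HasSupport P A) : indicatorVec A ∈ W := by
  obtain ⟨B, hB, hB'⟩ := h.exists_support P hP
  rwa [hA.unique hB]

theorem natCard_eq (h : M.HasSupportSpace S W) : Nat.card S = 2 ^ Module.finrank (ZMod 2) W := by
  choose s hs hs' using fun P : S => h.exists_support P P.2
  have hb : Function.Bijective (fun P : S => (⟨indicatorVec (s P), hs' P⟩ : W)) := by
    constructor
    · intro P Q hPQ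
      have h1 : s P = s Q := indicatorVec_injective (congrArg Subtype.val hPQ)
      exact Subtype.ext (h.eq_of_support P.2 Q.2 (hs P) (h1 ▸ hs Q))
    · intro w
      obtain ⟨P, hP, A, hA, hw⟩ := h.exists_mem w w.2
      refine ⟨⟨P, hP⟩, Subtype.ext ?_⟩
      rw [← hw, hA.unique (hs ⟨P, hP⟩)]
  rw [Nat.card_congr (Equiv.ofBijective _ hb), Module.natCard_eq_pow_finrank (K := ZMod 2),
    Nat.card_zmod]

/-- The dimension of the codespace is `2 ^ n / |S|`, since only the identity has a nonzero trace
among the elements of `S`. -/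
theorem finrank_codespace (h : M.HasSupportSpace S W) :
    Module.finrank ℂ (M.codespace S) * 2 ^ Module.finrank (ZMod 2) W = Module.finrank ℂ H := by
  have hcard := h.natCard_eq
  have hpos : 0 < Nat.card S := by rw [hcard]; positivity
  have : Finite S := Nat.finite_of_card_ne_zero hpos.ne'
  have := Fintype.ofFinite S
  have hne : (Nat.card S : ℂ) ≠ 0 := by exact_mod_cast hpos.ne'
  have := invertibleOfNonzero hne
  have := M.finiteDimensional
  let ρ : Representation ℂ S H := (Units.coeHom (Module.End ℂ H)).comp S.subtype
  have hinv : ρ.invariants = M.codespace S := by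
    ext x
    exact ⟨fun hx P hP => hx ⟨P, hP⟩, fun hx P => hx P P.2⟩
  have hsum := ρ.card_inv_mul_sum_char_eq_finrank
  have hchar : ∑ P : S, ρ.character P = Module.finrank ℂ H := by
    rw [Finset.sum_eq_single 1]
    · exact ρ.char_one
    · intro P _ hP
      obtain ⟨A, hA, -⟩ := h.exists_support P P.2
      refine hA.trace_eq_zero (Finset.nonempty_iff_ne_empty.2 fun h0 => hP ?_)
      exact Subtype.ext (h.eq_one P P.2 (h0 ▸ hA))
    · simp
  rw [hchar, hinv, inv_mul_eq_div, div_eq_iff hne, hcard] at hsum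
  exact_mod_cast hsum.symm

/-- A basis of the support space gives independent generators of the group. -/
theorem exists_generators (h : M.HasSupportSpace S W) :
    ∃ g : Fin (Module.finrank (ZMod 2) W) → (Module.End ℂ H)ˣ,
      Subgroup.closure (Set.range g) = S ∧ ∀ j, g j ∉ Subgroup.closure (g '' {j}ᶜ) := by
  let b := Module.finBasis (ZMod 2) W
  choose g hg s hs hsb using fun j => h.exists_mem (b j) (b j).2
  have hle : Subgroup.closure (Set.range g) ≤ S := by
    rw [Subgroup.closure_le]; rintro _ ⟨j, rfl⟩; exact hg j
  refine ⟨g, le_antisymm hle fun P hP => ?_, fun j hj => ?_⟩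
  · obtain ⟨A, hA, hAW⟩ := h.exists_support P hP
    have hspan : indicatorVec A ∈
        Submodule.span (ZMod 2) (Set.range fun j => (b j : V → ZMod 2)) := by
      have h1 : Set.range (fun j => (b j : V → ZMod 2)) = W.subtype '' Set.range b := by
        rw [← Set.range_comp]; rfl
      rw [h1, Submodule.span_image, b.span_eq]
      simpa using hAW
    obtain ⟨Q, hQ, B, hB, hBA⟩ :=
      exists_mem_of_mem_span (M := M) (K := Subgroup.closure (Set.range g)) (by
        rintro _ ⟨j, rfl⟩
        exact ⟨g j, Subgroup.subset_closure ⟨j, rfl⟩, s j, hs j, hsb j⟩) hspan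
    rw [indicatorVec_injective hBA] at hB
    rwa [h.eq_of_support hP (hle hQ) hA hB]
  · obtain ⟨A, hA, hA'⟩ := exists_support_of_mem_closure (M := M)
      (R := (fun j => (b j : V → ZMod 2)) '' {j}ᶜ) (by
        rintro _ ⟨i, hi, rfl⟩
        exact ⟨s i, hs i, i, hi, (hsb i).symm⟩) hj
    rw [hA.unique (hs j), hsb] at hA'
    have hli : LinearIndependent (ZMod 2) (fun j => (b j : V → ZMod 2)) :=
      b.linearIndependent.map' W.subtype W.ker_subtype
    exact hli.notMem_span_image (by simp) hA'

end HasSupportSpace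

/-- If products `c_A` commute, then phase factors can be chosen such that they generate a group
without `-1`. One of `±P` can be added to any commuting group without `-1` if `P * P = 1`. -/
theorem exists_phases {ι : Type*} [Finite ι] (M : MajoranaModes V H) (A : ι → Finset V)
    (hA : ∀ i j, M.op (A i) * M.op (A j) = M.op (A j) * M.op (A i)) :
    ∃ η : ι → rootsOfUnity 4 ℂ,
      (∀ P ∈ Subgroup.closure (Set.range fun i => scalar H (η i : ℂˣ) * M.op (A i)),
        ∀ Q ∈ Subgroup.closure (Set.range fun i => scalar H (η i : ℂˣ) * M.op (A i)),
          P * Q = Q * P) ∧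
      -1 ∉ Subgroup.closure (Set.range fun i => scalar H (η i : ℂˣ) * M.op (A i)) := by
  classical
  have hscal : ∀ (η : ℂˣ) (P : (Module.End ℂ H)ˣ), Commute (scalar H η) P := scalar_comm
  have hcomm : ∀ (η ζ : ℂˣ) (i j : ι),
      Commute (scalar H η * M.op (A i)) (scalar H ζ * M.op (A j)) := fun η ζ i j =>
    (hscal _ _).mul_left ((hscal _ _).symm.mul_right (hA i j))
  have := Fintype.ofFinite ι
  have key : ∀ s : Finset ι, ∃ (S : Subgroup (Module.End ℂ H)ˣ), -1 ∉ S ∧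
      (∀ P ∈ S, ∀ (η : ℂˣ) (i : ι), Commute P (scalar H η * M.op (A i))) ∧
      ∀ i ∈ s, ∃ η : rootsOfUnity 4 ℂ, scalar H (η : ℂˣ) * M.op (A i) ∈ S := by
    intro s
    induction s using Finset.induction with
    | empty =>
      refine ⟨⊥, ?_, ?_, by simp⟩
      · rw [Subgroup.mem_bot]; exact M.neg_ne_self 1
      · intro P hP η i
        rw [Subgroup.mem_bot.1 hP]
        exact Commute.one_left _
    | insert i s _ ih =>
      obtain ⟨S, hneg, hc, hS⟩ := ih
      obtain ⟨η, hη⟩ := M.exists_phase_mul_self (A i)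
      obtain ⟨P, hPdef⟩ : ∃ P, P = scalar H (η : ℂˣ) * M.op (A i) := ⟨_, rfl⟩
      rw [← hPdef] at hη
      by_cases hP : -P ∈ S
      · refine ⟨S, hneg, hc, fun j hj => ?_⟩
        rcases Finset.mem_insert.1 hj with rfl | hj
        · refine ⟨⟨-1, neg_one_mem⟩ * η, ?_⟩
          have : scalar H ((⟨-1, neg_one_mem⟩ * η : rootsOfUnity 4 ℂ) : ℂˣ) * M.op (A j) = -P := by
            rw [Subgroup.coe_mul, scalar_mul, scalar_neg_one, mul_assoc, neg_one_mul,
              hPdef]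
          rwa [this]
        · exact hS j hj
      · have hmem : ∀ Q ∈ S ⊔ Subgroup.zpowers P, Q ∈ S ∨ Q * P ∈ S := by
          intro Q hQ
          rw [Subgroup.sup_eq_closure] at hQ
          have hPc : ∀ Q ∈ S, Q * P = P * Q := fun Q hQ => hPdef ▸ hc Q hQ η i
          have hPinv : P⁻¹ = P := inv_eq_of_mul_eq_one_left hη
          induction hQ using Subgroup.closure_induction with
          | mem x hx =>
            rcases hx with hx | hx
            · exact Or.inl hx
            · obtain ⟨k, rfl⟩ := Subgroup.mem_zpowers_iff.1 hx
              rcases Int.even_or_odd' k with ⟨m, rfl | rfl⟩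
              · left; rw [zpow_mul, zpow_two, hη, one_zpow]; exact one_mem _
              · right; rw [zpow_add, zpow_mul, zpow_two, hη, one_zpow, one_mul, zpow_one, hη]
                exact one_mem _
          | one => exact Or.inl (one_mem _)
          | mul x y _ _ hx hy =>
            rcases hx with hx | hx <;> rcases hy with hy | hy
            · exact Or.inl (mul_mem hx hy)
            · right; rw [mul_assoc]; exact mul_mem hx hy
            · right
              rw [mul_assoc, hPc y hy, ← mul_assoc]
              exact mul_mem hx hy
            · left
              have h1 : P * (y * P) * P = y * P := by rw [← hPc _ hy, mul_assoc, hη, mul_one]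
              have h2 : x * P * (P * (y * P) * P) = x * (P * P) * y * (P * P) := by
                simp only [mul_assoc]
              rw [h1, hη, mul_one, mul_one] at h2
              exact h2 ▸ mul_mem hx hy
          | inv x _ hx =>
            rcases hx with hx | hx
            · exact Or.inl (inv_mem hx)
            · right
              have h1 : x⁻¹ * P = P * (x * P)⁻¹ * P := by
                rw [mul_inv_rev, hPinv, ← mul_assoc, hη, one_mul]
              rw [h1, ← hPc _ (inv_mem hx), mul_assoc, hη, mul_one]
              exact inv_mem hx
        refine ⟨S ⊔ Subgroup.zpowers P, fun h => ?_, fun Q hQ ζ j => ?_, fun j hj => ?_⟩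
        · rcases hmem _ h with h | h
          · exact hneg h
          · exact hP (by rwa [neg_one_mul] at h)
        · rcases hmem _ hQ with h | h
          · exact hc Q h ζ j
          · have h1 : Q = Q * P * P := by rw [mul_assoc, hη, mul_one]
            rw [h1]
            exact (hc _ h ζ j).mul_left (hPdef ▸ hcomm _ _ _ _)
        · rcases Finset.mem_insert.1 hj with rfl | hj
          · exact ⟨η, Subgroup.mem_sup_right (hPdef ▸ Subgroup.mem_zpowers P)⟩
          · obtain ⟨ζ, hζ⟩ := hS j hj
            exact ⟨ζ, Subgroup.mem_sup_left hζ⟩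
  obtain ⟨S, hneg, -, hS⟩ := key Finset.univ
  choose η hη using fun i => hS i (Finset.mem_univ i)
  refine ⟨η, ?_, fun h => hneg ?_⟩
  · have := Subgroup.isMulCommutative_closure
      (k := Set.range fun i => scalar H (η i : ℂˣ) * M.op (A i)) (by
        rintro _ ⟨i, rfl⟩ _ ⟨j, rfl⟩; exact hcomm _ _ _ _)
    exact fun P hP Q hQ => setLike_mul_comm hP hQ
  · refine (Subgroup.closure_le _).2 ?_ h
    rintro _ ⟨i, rfl⟩
    exact hη i

end MajoranaModes

/-! ### Darts around vertices and faces -/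

theorem Equiv.Perm.sum_sameCycle {D N : Type*} [Fintype D] [AddCommMonoid N] (f : Equiv.Perm D)
    (d : D) (F : D → N) (s : Finset D) (hs : ∀ e, e ∈ s ↔ f.SameCycle d e) :
    ∑ e ∈ s, F e = ∑ i ∈ Finset.range (Function.minimalPeriod f d), F (f^[i] d) := by
  symm
  refine Finset.sum_nbij (fun i => f^[i] d) ?_ ?_ ?_ (fun _ _ => rfl)
  · intro i _
    rw [hs]
    exact ⟨i, by simp [Equiv.Perm.iterate_eq_pow]⟩
  · intro i hi j hj h
    exact Function.iterate_injOn_Iio_minimalPeriod (by simpa using hi) (by simpa using hj) h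
  · intro e he
    obtain ⟨n, hn⟩ := ((hs e).1 he).exists_nat_pow_eq
    have hper : d ∈ Function.periodicPts f :=
      Function.mem_periodicPts.2 ⟨orderOf f, orderOf_pos f, by
        rw [Function.IsPeriodicPt, Function.IsFixedPt, Equiv.Perm.iterate_eq_pow, pow_orderOf_eq_one]
        rfl⟩
    refine ⟨n % Function.minimalPeriod f d, ?_, ?_⟩
    · simpa using Nat.mod_lt _ (Function.minimalPeriod_pos_of_mem_periodicPts hper)
    · change f^[_] d = e
      rw [Function.iterate_mod_minimalPeriod_eq, Equiv.Perm.iterate_eq_pow, hn]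

namespace CombinatorialMap

variable {D : Type*} {M : CombinatorialMap D}

theorem source_eq_iff {d e : D} : M.source d = M.source e ↔ M.σ.SameCycle d e := Quotient.eq

theorem face_eq_iff {d e : D} : M.face d = M.face e ↔ M.φ.SameCycle d e := Quotient.eq

theorem face_surjective : Function.Surjective M.face := Quotient.mk_surjective

theorem φ_apply (d : D) : M.φ d = M.σ (M.α d) := rfl

theorem source_σ (d : D) : M.source (M.σ d) = M.source d :=
  source_eq_iff.2 (Equiv.Perm.SameCycle.refl _ _).apply_left

theorem face_φ (d : D) : M.face (M.φ d) = M.face d :=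
  face_eq_iff.2 (Equiv.Perm.SameCycle.refl _ _).apply_left

/-- The faces on both sides of an edge are consecutive around its source. -/
theorem face_α (d : D) : M.face (M.α d) = M.face (M.σ d) := by
  rw [← face_φ, φ_apply, M.α_α]

theorem face_iterate (d : D) (n : ℕ) : M.face (M.φ^[n] d) = M.face d := by
  induction n with
  | zero => rfl
  | succ n ih => rw [Function.iterate_succ_apply', face_φ, ih]

theorem IsWalk.append {u v w : M.Vertex} {l₁ l₂ : List D} (h₁ : M.IsWalk u l₁ v)
    (h₂ : M.IsWalk v l₂ w) : M.IsWalk u (l₁ ++ l₂) w := by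
  induction h₁ with
  | nil _ => exact h₂
  | cons d _ ih => exact IsWalk.cons d (ih h₂)

/-- A relation between the face boundaries is an assignment `x` of values to the faces such that, at
each vertex, the sum over the three faces vanishes. Its value on the third face at an edge is the same
at both ends of the edge. -/
theorem relation_α {x : M.Face → ZMod 2}
    (hx : ∀ d, x (M.face d) + x (M.face (M.σ d)) + x (M.face (M.σ (M.σ d))) = 0) (d : D) :
    x (M.face (M.σ (M.σ (M.α d)))) = x (M.face (M.σ (M.σ d))) := by
  have h1 := hx d
  have h2 := hx (M.α d)
  rw [face_α, ← φ_apply, face_φ] at h2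
  rw [← φ_apply]
  revert h1 h2
  generalize x (M.face d) = a, x (M.face (M.σ d)) = b, x (M.face (M.σ (M.σ d))) = c,
    x (M.face (M.σ (M.φ d))) = e
  revert a b c e
  decide

section Fintype

variable [Fintype D]

theorem sum_source_eq {N : Type*} [AddCommMonoid N] [DecidableEq M.Vertex] (F : D → N) (d : D) :
    ∑ e with M.source e = M.source d, F e =
      ∑ i ∈ Finset.range (Function.minimalPeriod M.σ d), F (M.σ^[i] d) :=
  M.σ.sum_sameCycle d F _ fun e => by simp [eq_comm, source_eq_iff]

theorem sum_face_eq {N : Type*} [AddCommMonoid N] [DecidableEq M.Face] (F : D → N) (d : D) :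
    ∑ e with M.face e = M.face d, F e =
      ∑ i ∈ Finset.range (Function.minimalPeriod M.φ d), F (M.φ^[i] d) :=
  M.φ.sum_sameCycle d F _ fun e => by simp [eq_comm, face_eq_iff]

theorem faceLength_eq (d : D) : M.faceLength (M.face d) = Function.minimalPeriod M.φ d := by
  classical
  have := sum_face_eq (M := M) (fun _ => 1) d
  simp only [Finset.sum_const, smul_eq_mul, mul_one, Finset.card_range] at this
  rw [faceLength, Nat.card_eq_fintype_card, Fintype.card_subtype, this]

theorem minimalPeriod_σ (hdeg : ∀ v, M.degree v = 3) (d : D) :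
    Function.minimalPeriod M.σ d = 3 := by
  classical
  have := sum_source_eq (M := M) (fun _ => 1) d
  simp only [Finset.sum_const, smul_eq_mul, mul_one, Finset.card_range] at this
  rw [← hdeg (M.source d), degree, Nat.card_eq_fintype_card, Fintype.card_subtype, this]

theorem sum_source_eq_of_trivalent {N : Type*} [AddCommMonoid N] [DecidableEq M.Vertex]
    (hdeg : ∀ v, M.degree v = 3) (F : D → N) (d : D) :
    ∑ e with M.source e = M.source d, F e = F d + F (M.σ d) + F (M.σ (M.σ d)) := by
  rw [sum_source_eq, minimalPeriod_σ hdeg]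
  simp [Finset.sum_range_succ]

theorem σ_σ_σ (hdeg : ∀ v, M.degree v = 3) (d : D) : M.σ (M.σ (M.σ d)) = d := by
  have := Function.isPeriodicPt_minimalPeriod M.σ d
  rw [minimalPeriod_σ hdeg] at this
  exact this

theorem σ_σ_ne (hdeg : ∀ v, M.degree v = 3) (d : D) : M.σ (M.σ d) ≠ d := by
  intro h
  have h2 : Function.IsPeriodicPt M.σ 2 d := h
  have := h2.minimalPeriod_dvd
  rw [minimalPeriod_σ hdeg] at this
  omega

theorem eq_of_source_eq (hdeg : ∀ v, M.degree v = 3) {d e : D} (h : M.source e = M.source d) :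
    e = d ∨ e = M.σ d ∨ e = M.σ (M.σ d) := by
  classical
  by_contra! hne
  have := sum_source_eq_of_trivalent hdeg (fun x => if x = e then 1 else 0) d
  rw [if_neg hne.1.symm, if_neg hne.2.1.symm, if_neg hne.2.2.symm] at this
  simp [h] at this

theorem card_darts [Fintype M.Vertex] (hdeg : ∀ v, M.degree v = 3) :
    Fintype.card D = 3 * Fintype.card M.Vertex := by
  classical
  rw [← Finset.card_univ, Finset.card_eq_sum_card_fiberwise (f := M.source) (t := Finset.univ)
    (fun _ _ => Finset.mem_univ _)]
  have : ∀ v, (Finset.univ.filter fun d => M.source d = v).card = 3 := fun v => by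
    rw [← Fintype.card_subtype, ← Nat.card_eq_fintype_card]; exact hdeg v
  simp [this, mul_comm]

/-! ### Face boundaries as vectors over `𝔽₂` -/

theorem mem_faceVertices {f : M.Face} {v : M.Vertex} :
    v ∈ M.faceVertices f ↔ ∃ d, M.source d = v ∧ M.face d = f := by
  simp [faceVertices]

theorem card_faceVertices (hsimp : ∀ d e, M.source d = M.source e → M.face d = M.face e → d = e)
    (f : M.Face) : (M.faceVertices f).card = M.faceLength f := by
  classical
  have h : M.faceVertices f = (Finset.univ.filter fun d => M.face d = f).image M.source := by
    ext v; simp [mem_faceVertices, and_comm]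
  rw [h, Finset.card_image_of_injOn, faceLength, Nat.card_eq_fintype_card, Fintype.card_subtype]
  intro d hd e he hde
  simp only [Finset.coe_filter, Finset.mem_univ, true_and, Set.mem_ofPred_eq] at hd he
  exact hsimp d e hde (hd.trans he.symm)

/-- Two distinct faces have an even number of common vertices: at each common vertex there is
exactly one edge between the two faces, so that these edges pair the common vertices off. -/
theorem even_card_inter [DecidableEq M.Vertex] (hdeg : ∀ v, M.degree v = 3)
    (hsimp : ∀ d e, M.source d = M.source e → M.face d = M.face e → d = e)
    {f g : M.Face} (hfg : f ≠ g) : Even (M.faceVertices f ∩ M.faceVertices g).card := by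
  classical
  let T : Finset D := Finset.univ.filter fun d =>
    (M.face d = f ∧ M.face (M.α d) = g) ∨ (M.face d = g ∧ M.face (M.α d) = f)
  have hT : ∀ d, d ∈ T ↔
      (M.face d = f ∧ M.face (M.α d) = g) ∨ (M.face d = g ∧ M.face (M.α d) = f) := by
    simp [T]
  have heven : Even T.card := by
    rw [← ZMod.natCast_eq_zero_iff_even, Finset.card_eq_sum_ones, Nat.cast_sum]
    refine Finset.sum_involution (fun d _ => M.α d) (fun _ _ => by decide)
      (fun d _ _ => M.α_ne d) (fun d hd => ?_) (fun d _ => M.α_α d)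
    rw [hT, M.α_α]
    rcases (hT d).1 hd with h | h
    · exact Or.inr h.symm
    · exact Or.inl h.symm
  have himg : M.faceVertices f ∩ M.faceVertices g = T.image M.source := by
    ext v
    simp only [Finset.mem_inter, mem_faceVertices, Finset.mem_image, hT, face_α]
    constructor
    · rintro ⟨⟨d, rfl, hd⟩, ⟨e, he, he'⟩⟩
      rcases eq_of_source_eq hdeg he with rfl | rfl | rfl
      · exact absurd (hd.symm.trans he') hfg
      · exact ⟨d, Or.inl ⟨hd, he'⟩, rfl⟩
      · exact ⟨_, Or.inr ⟨he', by rw [σ_σ_σ hdeg]; exact hd⟩, he⟩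
    · rintro ⟨d, h | h, rfl⟩
      · exact ⟨⟨d, rfl, h.1⟩, ⟨_, source_σ d, h.2⟩⟩
      · exact ⟨⟨_, source_σ d, h.2⟩, ⟨d, rfl, h.1⟩⟩
  rw [himg, Finset.card_image_of_injOn]
  · exact heven
  intro d hd e he hde
  have hcross : ∀ d e, M.source d = M.source e → M.face d = M.face (M.σ e) →
      M.face e = M.face (M.σ d) → d = e := fun d e hde h1 h2 => by
    have h3 := hsimp d (M.σ e) (hde.trans (source_σ e).symm) h1
    have h4 := hsimp e (M.σ d) (hde.symm.trans (source_σ d).symm) h2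
    exact absurd (by rw [← h4, ← h3]) (σ_σ_ne hdeg d)
  have hd := (hT d).1 hd
  have he := (hT e).1 he
  rw [face_α] at hd he
  rcases hd with hd | hd <;> rcases he with he | he
  · exact hsimp d e hde (hd.1.trans he.1.symm)
  · exact hcross d e hde (hd.1.trans he.2.symm) (he.1.trans hd.2.symm)
  · exact hcross d e hde (hd.1.trans he.2.symm) (he.1.trans hd.2.symm)
  · exact hsimp d e hde (hd.1.trans he.1.symm)

theorem sum_smul_indicatorVec [DecidableEq M.Vertex] [Fintype M.Face]
    (hdeg : ∀ v, M.degree v = 3)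
    (hsimp : ∀ d e, M.source d = M.source e → M.face d = M.face e → d = e)
    (x : M.Face → ZMod 2) (d : D) :
    (∑ f, x f • indicatorVec (M.faceVertices f)) (M.source d) =
      x (M.face d) + x (M.face (M.σ d)) + x (M.face (M.σ (M.σ d))) := by
  classical
  rw [← sum_source_eq_of_trivalent hdeg (fun e => x (M.face e))]
  have h : ∀ f, indicatorVec (M.faceVertices f) (M.source d) =
      ∑ e with M.source e = M.source d, if M.face e = f then 1 else 0 := fun f => by
    rw [indicatorVec]
    split_ifs with hf
    · obtain ⟨e, he, he'⟩ := mem_faceVertices.1 hf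
      rw [Finset.sum_eq_single e]
      · rw [if_pos he']
      · intro e' h1 h2
        simp only [Finset.mem_filter, Finset.mem_univ, true_and] at h1
        exact if_neg fun h3 => h2 (hsimp _ _ (h1.trans he.symm) (h3.trans he'.symm))
      · simp [he]
    · refine (Finset.sum_eq_zero fun e he => if_neg fun h => hf ?_).symm
      exact mem_faceVertices.2 ⟨e, by simpa using he, h⟩
  simp only [Finset.sum_apply, Pi.smul_apply, h, smul_eq_mul, Finset.mul_sum]
  rw [Finset.sum_comm]
  simp

/-! ### Relations between face boundaries -/

section Relations

variable {x : M.Face → ZMod 2}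

/-- If a relation has the value `a` on a face, then its values on the neighbouring faces alternate
between some `b` and `b + a` along the boundary. So `a = 0` if the boundary has odd length. -/
theorem relation_eq_zero_of_odd (hdeg : ∀ v, M.degree v = 3)
    (hx : ∀ d, x (M.face d) + x (M.face (M.σ d)) + x (M.face (M.σ (M.σ d))) = 0) {f : M.Face}
    (hf : Odd (M.faceLength f)) : x f = 0 := by
  obtain ⟨d, rfl⟩ := face_surjective f
  have hstep : ∀ d, x (M.face (M.σ (M.σ (M.φ d)))) =
      x (M.face (M.σ (M.σ d))) + x (M.face d) := fun d => by
    rw [φ_apply, σ_σ_σ hdeg, face_α]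
    have h1 := hx d
    revert h1
    generalize x (M.face d) = a, x (M.face (M.σ d)) = b, x (M.face (M.σ (M.σ d))) = c
    revert a b c
    decide
  have hiter : ∀ n : ℕ, x (M.face (M.σ (M.σ (M.φ^[n] d)))) =
      x (M.face (M.σ (M.σ d))) + n * x (M.face d) := by
    intro n
    induction n with
    | zero => simp
    | succ n ih =>
      rw [Function.iterate_succ_apply', hstep, ih, face_iterate]
      push_cast
      ring
  have h := hiter (Function.minimalPeriod M.φ d)
  rw [Function.iterate_minimalPeriod, ← faceLength_eq, (ZMod.natCast_eq_one_iff_odd).2 hf,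
    one_mul] at h
  exact left_eq_add.1 h

/-- A relation that vanishes around one vertex vanishes around its neighbours. -/
theorem relation_eq_zero_of_walk (hdeg : ∀ v, M.degree v = 3)
    (hx : ∀ d, x (M.face d) + x (M.face (M.σ d)) + x (M.face (M.σ (M.σ d))) = 0)
    {v w : M.Vertex} {l : List D} (hl : M.IsWalk v l w)
    (hv : ∀ d, M.source d = v → x (M.face d) = 0) : ∀ d, M.source d = w → x (M.face d) = 0 := by
  induction hl with
  | nil v => exact hv
  | cons d _ ih =>
    apply ih
    have h1 : x (M.face (M.α d)) = 0 := by
      rw [face_α]; exact hv _ (source_σ d)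
    have h2 : x (M.face (M.σ (M.α d))) = 0 := by
      rw [← φ_apply, face_φ]; exact hv d rfl
    have h3 : x (M.face (M.σ (M.σ (M.α d)))) = 0 := by
      rw [relation_α hx]
      exact hv _ ((source_σ _).trans (source_σ d))
    intro e he
    rcases eq_of_source_eq hdeg he with rfl | rfl | rfl
    exacts [h1, h2, h3]

/-- With an odd face and connectedness, the value on one face next to the odd face determines a
relation. -/
theorem relation_eq_zero (hdeg : ∀ v, M.degree v = 3) (hconn : M.IsConnected)
    (hx : ∀ d, x (M.face d) + x (M.face (M.σ d)) + x (M.face (M.σ (M.σ d))) = 0)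
    {d : D} (hd : Odd (M.faceLength (M.face d))) (h : x (M.face (M.σ d)) = 0) : x = 0 := by
  have h0 := relation_eq_zero_of_odd hdeg hx hd
  have h2 := hx d
  rw [h0, h, zero_add, zero_add] at h2
  have hv : ∀ e, M.source e = M.source d → x (M.face e) = 0 := fun e he => by
    rcases eq_of_source_eq hdeg he with rfl | rfl | rfl
    exacts [h0, h, h2]
  funext f
  obtain ⟨e, rfl⟩ := face_surjective f
  obtain ⟨l, hl⟩ := hconn (M.source d) (M.source e)
  exact relation_eq_zero_of_walk hdeg hx hl hv e rfl

/-- There is at most one nontrivial relation between the face boundaries. -/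
theorem card_face_le_finrank_span [DecidableEq M.Vertex] [Fintype M.Vertex] [Fintype M.Face]
    (hdeg : ∀ v, M.degree v = 3)
    (hsimp : ∀ d e, M.source d = M.source e → M.face d = M.face e → d = e)
    (hconn : M.IsConnected) {f : M.Face} (hf : Odd (M.faceLength f)) :
    Fintype.card M.Face ≤ Module.finrank (ZMod 2)
      (Submodule.span (ZMod 2) (Set.range fun f => indicatorVec (M.faceVertices f))) + 1 := by
  obtain ⟨d, rfl⟩ := face_surjective f
  let Φ := Fintype.linearCombination (ZMod 2) (fun f => indicatorVec (M.faceVertices f))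
  have hrk := Φ.finrank_range_add_finrank_ker
  rw [Module.finrank_fintype_fun_eq_card, Fintype.range_linearCombination] at hrk
  let ev : LinearMap.ker Φ →ₗ[ZMod 2] ZMod 2 :=
    (LinearMap.proj (M.face (M.σ d))).comp (LinearMap.ker Φ).subtype
  have hinj : Function.Injective ev := by
    rw [← LinearMap.ker_eq_bot, LinearMap.ker_eq_bot']
    intro x hx
    refine Subtype.ext (relation_eq_zero hdeg hconn (fun e => ?_) hf hx)
    rw [← sum_smul_indicatorVec hdeg hsimp]
    exact congrFun (LinearMap.mem_ker.1 x.2) (M.source e)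
  have := LinearMap.finrank_le_finrank_of_injective hinj
  rw [Module.finrank_self] at this
  omega

end Relations

/-! ### The Euler characteristic -/

theorem sum_faceWalk [DecidableEq M.Face] (a : D → ZMod 2) (d : D) :
    ((M.faceWalk d).map a).sum = ∑ e with M.face e = M.face d, a e := by
  rw [sum_face_eq, faceWalk, Finset.sum_range, ← List.sum_ofFn]
  congr 1
  apply List.ext_getElem <;> simp

/-- On a simply connected surface, a function on the edges whose sum around each face vanishes is
a coboundary. -/
theorem exists_coboundary [Nonempty D] [DecidableEq M.Face] (hconn : M.IsConnected)
    (hsc : M.IsSimplyConnected) {a : D → ZMod 2} (hα : ∀ d, a (M.α d) = a d)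
    (hface : ∀ d, ∑ e with M.face e = M.face d, a e = 0) :
    ∃ b : M.Vertex → ZMod 2, ∀ d, a d = b (M.source d) + b (M.target d) := by
  have hprod : ∀ l : List D,
      (l.map fun d => Multiplicative.ofAdd (a d)).prod = Multiplicative.ofAdd (l.map a).sum := by
    intro l
    induction l with
    | nil => rfl
    | cons d l ih => simp [ih]
  have hrel : ∀ r ∈ M.homotopyRels,
      FreeGroup.lift (fun d => Multiplicative.ofAdd (a d)) r = 1 := by
    rintro r (⟨d, rfl⟩ | ⟨d, rfl⟩)
    · simp only [map_mul, FreeGroup.lift_apply_of, hα, ← ofAdd_add]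
      rw [CharTwo.add_self_eq_zero, ofAdd_zero]
    · rw [map_list_prod, List.map_map]
      have : (FreeGroup.lift fun d => Multiplicative.ofAdd (a d)) ∘ FreeGroup.of =
        fun d => Multiplicative.ofAdd (a d) := by funext d; simp
      rw [this, hprod, sum_faceWalk, hface, ofAdd_zero]
  have hclosed : ∀ v l, M.IsWalk v l v → (l.map a).sum = 0 := by
    intro v l hl
    have h := congrArg (PresentedGroup.toGroup hrel) (hsc v l hl)
    rw [map_list_prod, List.map_map, map_one] at h
    have : (PresentedGroup.toGroup hrel) ∘ PresentedGroup.of (rels := M.homotopyRels) =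
        fun d => Multiplicative.ofAdd (a d) := by
      funext d; exact PresentedGroup.toGroup.of hrel
    rw [this, hprod] at h
    exact ofAdd_eq_one.1 h
  let v₀ := M.source (Classical.arbitrary D)
  choose p hp using fun v => hconn v₀ v
  choose q hq using fun v => hconn v v₀
  refine ⟨fun v => ((p v).map a).sum, fun d => ?_⟩
  have h1 := hclosed _ _ ((hp (M.source d)).append (IsWalk.cons d (hq (M.target d))))
  have h2 := hclosed _ _ ((hp (M.target d)).append (hq (M.target d)))
  simp only [List.map_append, List.map_cons, List.sum_append, List.sum_cons] at h1 h2
  beta_reduce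
  revert h1 h2
  generalize a d = x, ((p (M.source d)).map a).sum = y, ((p (M.target d)).map a).sum = z,
    ((q (M.target d)).map a).sum = t
  revert x y z t
  decide

/-- The inequality `E + 2 ≤ V + F` for a connected and simply connected surface; the number of
darts is `2 E`. By `exists_coboundary`, the space of functions on the edges has at most `V - 1`
dimensions more than the rank of the face constraints, and this rank is at most `F - 1`, since each
edge is on the boundary of two faces. -/
theorem card_darts_add_four_le [Nonempty D] [Fintype M.Vertex] [Fintype M.Face]
    (hconn : M.IsConnected) (hsc : M.IsSimplyConnected) :
    Fintype.card D + 4 ≤ 2 * (Fintype.card M.Vertex + Fintype.card M.Face) := by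
  classical
  let T : (D → ZMod 2) →ₗ[ZMod 2] (D → ZMod 2) :=
    LinearMap.id + LinearMap.funLeft (ZMod 2) (ZMod 2) M.α
  have hT : ∀ a d, T a d = a d + a (M.α d) := fun _ _ => rfl
  have hker : ∀ a, a ∈ LinearMap.ker T ↔ ∀ d, a (M.α d) = a d := fun a => by
    rw [LinearMap.mem_ker, funext_iff]
    refine forall_congr' fun d => ?_
    rw [hT, Pi.zero_apply, CharTwo.add_eq_zero, eq_comm]
  -- the range of `T` consists of functions on the edges, too
  have hrange : LinearMap.range T ≤ LinearMap.ker T := by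
    rintro _ ⟨a, rfl⟩
    rw [hker]
    intro d
    rw [hT, hT, M.α_α, add_comm]
  have h1 := T.finrank_range_add_finrank_ker
  rw [Module.finrank_fintype_fun_eq_card] at h1
  have h2 := Submodule.finrank_mono hrange
  let L₀ : (D → ZMod 2) →ₗ[ZMod 2] (M.Face → ZMod 2) :=
    LinearMap.pi fun f => ∑ d with M.face d = f, LinearMap.proj d
  have hL₀ : ∀ a f, L₀ a f = ∑ d with M.face d = f, a d := fun a f => by simp [L₀]
  let L := L₀.comp (LinearMap.ker T).subtype
  have h3 := L.finrank_range_add_finrank_ker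
  let s : (M.Face → ZMod 2) →ₗ[ZMod 2] ZMod 2 := ∑ f, LinearMap.proj f
  have hs : ∀ x, s x = ∑ f, x f := fun x => by simp [s]
  have hLs : LinearMap.range L ≤ LinearMap.ker s := by
    rintro _ ⟨a, rfl⟩
    have ha := (hker _).1 a.2
    rw [LinearMap.mem_ker, hs]
    change ∑ f, L₀ a f = 0
    simp only [hL₀]
    refine (Finset.sum_fiberwise Finset.univ M.face _).trans ?_
    refine Finset.sum_involution (fun d _ => M.α d) (fun d _ => ?_) (fun d _ _ => M.α_ne d)
      (fun _ _ => Finset.mem_univ _) (fun d _ => M.α_α d)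
    rw [ha, CharTwo.add_self_eq_zero]
  have h4 := Submodule.finrank_mono hLs
  have hsurj : LinearMap.range s = ⊤ := by
    rw [LinearMap.range_eq_top]
    intro c
    exact ⟨Pi.single (M.face (Classical.arbitrary D)) c, by simp [hs]⟩
  have h5 := s.finrank_range_add_finrank_ker
  rw [hsurj, finrank_top, Module.finrank_self, Module.finrank_fintype_fun_eq_card] at h5
  let δ : (M.Vertex → ZMod 2) →ₗ[ZMod 2] (D → ZMod 2) :=
    LinearMap.funLeft (ZMod 2) (ZMod 2) M.source + LinearMap.funLeft (ZMod 2) (ZMod 2) M.target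
  have hδ : ∀ b d, δ b d = b (M.source d) + b (M.target d) := fun _ _ => rfl
  have h6 := δ.finrank_range_add_finrank_ker
  rw [Module.finrank_fintype_fun_eq_card] at h6
  have h7 : 0 < Module.finrank (ZMod 2) (LinearMap.ker δ) := by
    rw [Module.finrank_pos_iff_exists_ne_zero]
    refine ⟨⟨1, ?_⟩, fun h => ?_⟩
    · rw [LinearMap.mem_ker]
      funext d
      rw [hδ, Pi.one_apply, Pi.one_apply, CharTwo.add_self_eq_zero, Pi.zero_apply]
    · exact one_ne_zero (congrFun (congrArg Subtype.val h) (M.source (Classical.arbitrary D)))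
  have hLδ : (LinearMap.ker L).map (LinearMap.ker T).subtype ≤ LinearMap.range δ := by
    rintro _ ⟨a, ha, rfl⟩
    obtain ⟨b, hb⟩ := exists_coboundary hconn hsc ((hker _).1 a.2) fun d => by
      rw [← hL₀]
      exact congrFun (LinearMap.mem_ker.1 ha) _
    exact ⟨b, funext fun d => ((hδ b d).trans (hb d).symm)⟩
  have h8 := Submodule.finrank_mono hLδ
  rw [Submodule.finrank_map_subtype_eq] at h8
  omega

end Fintype

end CombinatorialMap

/-! ### Logical operators -/

namespace MajoranaModes

variable {V H : Type*} [LinearOrder V] [NormedAddCommGroup H] [InnerProductSpace ℂ H]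
  {M : MajoranaModes V H} {S : Subgroup (Module.End ℂ H)ˣ} {W : Submodule (ZMod 2) (V → ZMod 2)}

/-- In terms of supports, commuting with even operators is orthogonality over `𝔽₂`. -/
theorem HasSupportSpace.mem_centralizer [Fintype V] (h : M.HasSupportSpace S W)
    (hW : ∀ B, indicatorVec B ∈ W → Even B.card) {P : (Module.End ℂ H)ˣ} {A : Finset V}
    (hP : M.HasSupport P A) :
    P ∈ M.centralizer S ↔ ∀ w ∈ W, w ⬝ᵥ indicatorVec A = 0 := by
  have hiff : ∀ B, indicatorVec B ∈ W →
      (Even (B.card * A.card + (B ∩ A).card) ↔ indicatorVec B ⬝ᵥ indicatorVec A = 0) := by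
    intro B hB
    rw [dotProduct_indicatorVec, ZMod.natCast_eq_zero_iff_even, Nat.even_add]
    simp [(hW B hB).mul_right]
  constructor
  · rintro ⟨-, hc⟩ w hw
    obtain ⟨Q, hQ, B, hB, rfl⟩ := h.exists_mem w hw
    exact (hiff B hw).1 (hB.even_of_commute hP (Subgroup.mem_centralizer_iff.1 hc Q hQ))
  · intro hc
    refine ⟨hP.mem_majoranaGroup, Subgroup.mem_centralizer_iff.2 fun Q hQ => ?_⟩
    obtain ⟨B, hB, hBW⟩ := h.exists_support Q hQ
    exact hB.commute hP ((hiff B hBW).2 (hc _ hBW))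

/-- Anticommuting elements of the centralizer are logical operators. -/
theorem isLogical_of_anticommute {P Q : (Module.End ℂ H)ˣ} (hP : P ∈ M.centralizer S)
    (hQ : Q ∈ M.centralizer S) (h : P * Q = -(Q * P)) : M.IsLogical S P := by
  refine ⟨hP, fun hPS => M.neg_ne_self (Q * P) ?_⟩
  rw [← h]
  exact Subgroup.mem_centralizer_iff.1 hQ.2 P hPS

/-- Two disjoint odd sets that, together with `W`, span the orthogonal complement of `W` give the
logical Pauli operators of a code with support space `W`. -/
theorem HasSupportSpace.isLogicalPauli [Fintype V] (h : M.HasSupportSpace S W)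
    (hS : ∀ P ∈ S, ∀ Q ∈ S, P * Q = Q * P) (hW : ∀ B, indicatorVec B ∈ W → Even B.card)
    {A : Fin 2 → Finset V} (hodd : ∀ a, Odd (A a).card) (hdisj : Disjoint (A 0) (A 1))
    (horth : ∀ a, ∀ w ∈ W, w ⬝ᵥ indicatorVec (A a) = 0)
    (hperp : ∀ x, (∀ w ∈ W, w ⬝ᵥ x = 0) →
      x ∈ W ⊔ Submodule.span (ZMod 2) (Set.range fun a => indicatorVec (A a)))
    {X Y Z : (Module.End ℂ H)ˣ} (hX : M.HasSupport X (A 0)) (hY : M.HasSupport Y (A 1))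
    (hXX : X * X = 1) (hYY : Y * Y = 1) (hZ : Z = (scalar H iUnit)⁻¹ * X * Y) :
    M.IsLogicalPauli S X Y Z := by
  obtain ⟨J, hJ⟩ : ∃ J, J = scalar H iUnit := ⟨_, rfl⟩
  have hJc : ∀ P, J * P = P * J := fun P => hJ ▸ scalar_comm _ P
  have hJJ : J * J = -1 := by
    rw [hJ, ← scalar_mul, ← sq, iUnit_sq, scalar_neg_one]
  have hJinv : J⁻¹ = -J := inv_eq_of_mul_eq_one_left (by rw [neg_mul, hJJ, neg_neg])
  have hXY : X * Y = -(Y * X) := hX.anticommute hY (by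
    rw [Finset.disjoint_iff_inter_eq_empty.1 hdisj, Finset.card_empty, add_zero]
    exact (hodd 0).mul (hodd 1))
  have hYX : Y * X = -(X * Y) := by rw [hXY, neg_neg]
  have hZ' : Z = -(J * (X * Y)) := by rw [hZ, ← hJ, hJinv, neg_mul, neg_mul, mul_assoc]
  have hXZ : X * Z = -(J * Y) := by
    rw [hZ', mul_neg, ← mul_assoc, ← hJc, mul_assoc, ← mul_assoc X X, hXX, one_mul]
  have hZX : Z * X = J * Y := by
    rw [hZ', neg_mul, mul_assoc, mul_assoc, hYX, mul_neg, mul_neg, neg_neg, ← mul_assoc X X, hXX,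
      one_mul]
  have hYZ : Y * Z = J * X := by
    rw [hZ', mul_neg, ← mul_assoc, ← hJc, mul_assoc, ← mul_assoc Y X, hYX, neg_mul, mul_neg,
      neg_neg, mul_assoc, hYY, mul_one]
  have hZY : Z * Y = -(J * X) := by
    rw [hZ', neg_mul, mul_assoc, mul_assoc, hYY, mul_one]
  have hZZ : Z * Z = 1 := by
    nth_rewrite 2 [hZ']
    rw [mul_neg, ← mul_assoc, ← hJc, mul_assoc, ← mul_assoc Z, hZX, mul_assoc, hYY, mul_one, hJJ,
      neg_neg]
  have hXc := (h.mem_centralizer hW hX).2 (horth 0)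
  have hYc := (h.mem_centralizer hW hY).2 (horth 1)
  have hJg : J ∈ M.centralizer S := by
    rw [hJ]
    exact ⟨(hasSupport_scalar iUnit_mem).mem_majoranaGroup,
      Subgroup.mem_centralizer_iff.2 fun P _ => (scalar_comm _ P).symm⟩
  have hZc : Z ∈ M.centralizer S := by
    rw [hZ, ← hJ]
    exact mul_mem (mul_mem (inv_mem hJg) hXc) hYc
  have hZX' : Z * X = -(X * Z) := by rw [hZX, hXZ, neg_neg]
  refine ⟨⟨isLogical_of_anticommute hXc hYc hXY, isLogical_of_anticommute hYc hXc hYX,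
    isLogical_of_anticommute hZc hXc hZX'⟩, ⟨isSymmetric_of_mul_self hXc.1 hXX,
    isSymmetric_of_mul_self hYc.1 hYY, isSymmetric_of_mul_self hZc.1 hZZ⟩, ⟨hXX, hYY, hZZ⟩,
    ⟨hXY, by rw [hYZ, hZY, neg_neg], hZX'⟩, by rw [hZ, mul_assoc, mul_inv_cancel_left], ?_⟩
  rw [← hJ]
  apply le_antisymm
  · intro P hP
    obtain ⟨C, hC⟩ := mem_majoranaGroup.1 hP.1
    have hspan := hperp _ ((h.mem_centralizer hW hC).1 hP)
    rw [← Submodule.span_eq W, ← Submodule.span_union] at hspan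
    obtain ⟨Q, hQ, B, hB, hBC⟩ := exists_mem_of_mem_span (M := M)
      (K := Subgroup.closure ({J} ∪ (S : Set (Module.End ℂ H)ˣ) ∪ {X, Y, Z})) (by
        rintro x (hx | ⟨a, rfl⟩)
        · obtain ⟨P, hP, A, hA, hw⟩ := h.exists_mem x hx
          exact ⟨P, Subgroup.subset_closure (Or.inl (Or.inr hP)), A, hA, hw⟩
        · fin_cases a
          · exact ⟨X, Subgroup.subset_closure (by simp), _, hX, rfl⟩
          · exact ⟨Y, Subgroup.subset_closure (by simp), _, hY, rfl⟩) hspan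
    rw [indicatorVec_injective hBC] at hB
    have hPQ := hC.mul hB.inv
    rw [symmDiff_self, Finset.bot_eq_empty] at hPQ
    obtain ⟨η, hη, hPQ⟩ := hPQ.eq_scalar
    rw [mul_inv_eq_iff_eq_mul.1 hPQ]
    refine mul_mem (Subgroup.closure_mono ?_ (rootsOfUnity_scalar_mem hη)) hQ
    rw [← hJ]
    exact fun x hx => Or.inl (Or.inl hx)
  · rw [Subgroup.closure_le]
    rintro P ((hP | hP) | hP)
    · rw [Set.mem_singleton_iff.1 hP]; exact hJg
    · obtain ⟨A, hA, -⟩ := h.exists_support P hP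
      exact ⟨hA.mem_majoranaGroup, Subgroup.mem_centralizer_iff.2 fun Q hQ => hS Q hQ P hP⟩
    · rcases hP with rfl | rfl | rfl
      exacts [hXc, hYc, hZc]

end MajoranaModes

/-! ### Self-orthogonal subspaces of `𝔽₂^V` -/

theorem dotProduct_eq_zero_of_mem_span {V : Type*} [Fintype V] {R T : Set (V → ZMod 2)}
    (h : ∀ x ∈ R, ∀ y ∈ T, x ⬝ᵥ y = 0) :
    ∀ x ∈ Submodule.span (ZMod 2) R, ∀ y ∈ Submodule.span (ZMod 2) T, x ⬝ᵥ y = 0 := by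
  intro x hx y hy
  induction hx using Submodule.span_induction with
  | mem x hx =>
    induction hy using Submodule.span_induction with
    | mem y hy => exact h x hx y hy
    | zero => simp
    | add y z _ _ hy hz => rw [dotProduct_add, hy, hz, add_zero]
    | smul a y _ hy => rw [dotProduct_smul, hy, smul_zero]
  | zero => simp
  | add x z _ _ hx hz => rw [add_dotProduct, hx, hz, add_zero]
  | smul a x _ hx => rw [smul_dotProduct, hx, smul_zero]

/-- If `U` is orthogonal to `W`, and its dimension is large but at most `2` more than that of `W`,
then `U` is the orthogonal complement of `W`, and the dimension of `W` is determined. -/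
theorem eq_orthogonal_of_finrank {V : Type*} [Fintype V] {n : ℕ} (hV : Fintype.card V = 2 * n)
    {U W : Submodule (ZMod 2) (V → ZMod 2)} (hUW : ∀ w ∈ W, ∀ u ∈ U, w ⬝ᵥ u = 0)
    (hle : Module.finrank (ZMod 2) U ≤ Module.finrank (ZMod 2) W + 2)
    (hge : n + 1 ≤ Module.finrank (ZMod 2) U) :
    Module.finrank (ZMod 2) W + 1 = n ∧ ∀ x, (∀ w ∈ W, w ⬝ᵥ x = 0) → x ∈ U := by
  classical
  let B : LinearMap.BilinForm (ZMod 2) (V → ZMod 2) := Matrix.toBilin' 1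
  have hB : ∀ x y, B x y = x ⬝ᵥ y := fun x y => by
    rw [Matrix.toBilin'_apply', Matrix.one_mulVec]
  have hnd : B.Nondegenerate := LinearMap.BilinForm.nondegenerate_toBilin'_of_det_ne_zero' _ (by simp)
  have hmem : ∀ x, x ∈ B.orthogonal W ↔ ∀ w ∈ W, w ⬝ᵥ x = 0 := fun x => by
    simp only [LinearMap.BilinForm.mem_orthogonal_iff, hB]
  have hdim := LinearMap.BilinForm.finrank_orthogonal hnd W
  rw [Module.finrank_fintype_fun_eq_card, hV] at hdim
  have hsub : U ≤ B.orthogonal W := fun u hu => (hmem u).2 fun w hw => hUW w hw u hu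
  have hmono := Submodule.finrank_mono hsub
  have hWle := Submodule.finrank_le W
  rw [Module.finrank_fintype_fun_eq_card, hV] at hWle
  refine ⟨by omega, fun x hx => ?_⟩
  rw [Submodule.eq_of_le_of_finrank_le hsub (by omega)]
  exact (hmem x).2 hx

namespace CylinderDecomposition

variable {D : Type*} {G : CylinderDecomposition D}

theorem disjoint_boundaryVertices [Finite D] :
    Disjoint (G.boundaryVertices 0) (G.boundaryVertices 1) := by
  have := Fintype.ofFinite D
  rw [Finset.disjoint_left]
  intro v h0 h1
  obtain ⟨d, rfl, hd⟩ := CombinatorialMap.mem_faceVertices.1 h0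
  obtain ⟨e, he, he'⟩ := CombinatorialMap.mem_faceVertices.1 h1
  exact G.ext_disjoint d e hd he' he.symm

theorem IsColorGraph.even_faceVertices [Finite D] (hG : G.IsColorGraph) (f : G.Face) :
    Even (G.faceVertices f).card := by
  have := Fintype.ofFinite D
  rw [faceVertices, CombinatorialMap.card_faceVertices G.faceBoundary_simple]
  exact hG.even_face f

theorem IsColorGraph.odd_boundaryVertices [Finite D] (hG : G.IsColorGraph) (a : Fin 2) :
    Odd (G.boundaryVertices a).card := by
  have := Fintype.ofFinite D
  rw [boundaryVertices, CombinatorialMap.card_faceVertices G.faceBoundary_simple]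
  exact hG.odd_boundary a

theorem IsColorGraph.even_inter [Finite D] [DecidableEq G.Vertex] (hG : G.IsColorGraph)
    (f g : G.Face) : Even (G.faceVertices f ∩ G.faceVertices g).card := by
  have := Fintype.ofFinite D
  by_cases h : f = g
  · rw [h, Finset.inter_self]
    exact hG.even_faceVertices g
  · exact CombinatorialMap.even_card_inter hG.trivalent G.faceBoundary_simple
      fun h' => h (Subtype.ext h')

theorem IsColorGraph.even_inter_boundary [Finite D] [DecidableEq G.Vertex] (hG : G.IsColorGraph)
    (f : G.Face) (a : Fin 2) : Even (G.faceVertices f ∩ G.boundaryVertices a).card := by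
  have := Fintype.ofFinite D
  exact CombinatorialMap.even_card_inter hG.trivalent G.faceBoundary_simple (f.2 a)

/-- The span over `𝔽₂` of the vertex sets of the faces of the cylinder. -/
def faceSpan [Finite D] (G : CylinderDecomposition D) [DecidableEq G.Vertex] :
    Submodule (ZMod 2) (G.Vertex → ZMod 2) :=
  Submodule.span (ZMod 2) (Set.range fun f => indicatorVec (G.faceVertices f))

theorem IsColorGraph.even_of_mem_faceSpan [Finite D] [DecidableEq G.Vertex]
    (hG : G.IsColorGraph) {A : Finset G.Vertex} (hA : indicatorVec A ∈ G.faceSpan) :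
    Even A.card := by
  have := Fintype.ofFinite G.Vertex
  rw [← ZMod.natCast_eq_zero_iff_even, ← sum_indicatorVec, ← dotProduct_one]
  refine dotProduct_eq_zero_of_mem_span ?_ _ hA _ (Submodule.mem_span_singleton_self 1)
  rintro _ ⟨f, rfl⟩ _ rfl
  rw [dotProduct_one, sum_indicatorVec, ZMod.natCast_eq_zero_iff_even]
  exact hG.even_faceVertices f

theorem IsColorGraph.dotProduct_boundary [Finite D] [DecidableEq G.Vertex] [Fintype G.Vertex]
    (hG : G.IsColorGraph) (a : Fin 2) :
    ∀ w ∈ G.faceSpan, w ⬝ᵥ indicatorVec (G.boundaryVertices a) = 0 := by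
  intro w hw
  refine dotProduct_eq_zero_of_mem_span ?_ _ hw _ (Submodule.mem_span_singleton_self _)
  rintro _ ⟨f, rfl⟩ _ rfl
  rw [dotProduct_indicatorVec, ZMod.natCast_eq_zero_iff_even]
  exact hG.even_inter_boundary f a

/-- By the Euler characteristic, there are at least `n` faces on the cylinder with `2 n` vertices.
There is at most one relation between them and the two boundary circles. So the faces span a
subspace of dimension `n - 1`, and the orthogonal complement is spanned by the faces and the boundary
circles. -/
theorem IsColorGraph.finrank_faceSpan [Finite D] [DecidableEq G.Vertex] [Fintype G.Vertex]
    (hG : G.IsColorGraph) :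
    2 * (Module.finrank (ZMod 2) G.faceSpan + 1) = Fintype.card G.Vertex ∧
      ∀ x, (∀ w ∈ G.faceSpan, w ⬝ᵥ x = 0) → x ∈ G.faceSpan ⊔
        Submodule.span (ZMod 2) (Set.range fun a => indicatorVec (G.boundaryVertices a)) := by
  classical
  have := Fintype.ofFinite D
  have : Fintype G.toCombinatorialMap.Face := Fintype.ofFinite _
  have : Nonempty D := by
    obtain ⟨d, -⟩ := CombinatorialMap.face_surjective (G.ext 0)
    exact ⟨d⟩
  obtain ⟨n, hn⟩ := hG.even_card
  rw [Nat.card_eq_fintype_card, ← two_mul] at hn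
  set B := Submodule.span (ZMod 2) (Set.range fun a => indicatorVec (G.boundaryVertices a))
  have hD := CombinatorialMap.card_darts hG.trivalent
  have heuler := CombinatorialMap.card_darts_add_four_le G.connected G.simplyConnected
  have hrank := CombinatorialMap.card_face_le_finrank_span hG.trivalent G.faceBoundary_simple
    G.connected (hG.odd_boundary 0)
  have hle : Submodule.span (ZMod 2)
      (Set.range fun f => indicatorVec (G.toCombinatorialMap.faceVertices f)) ≤
        G.faceSpan ⊔ B := by
    rw [Submodule.span_le]
    rintro _ ⟨f, rfl⟩
    by_cases hf : ∀ a, f ≠ G.ext a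
    · exact Submodule.mem_sup_left (Submodule.subset_span ⟨⟨f, hf⟩, rfl⟩)
    · push Not at hf
      obtain ⟨a, rfl⟩ := hf
      exact Submodule.mem_sup_right (Submodule.subset_span ⟨a, rfl⟩)
  have hB : Module.finrank (ZMod 2) B ≤ 2 :=
    finrank_range_le_card (R := ZMod 2)
      (fun a => indicatorVec (G.boundaryVertices a))
  have hmono := Submodule.finrank_mono hle
  have hsup := Submodule.finrank_add_le_finrank_add_finrank G.faceSpan B
  have horth : ∀ w ∈ G.faceSpan, ∀ u ∈ G.faceSpan ⊔ B, w ⬝ᵥ u = 0 := by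
    intro w hw u hu
    rw [faceSpan, ← Submodule.span_union] at hu
    refine dotProduct_eq_zero_of_mem_span ?_ w hw u hu
    rintro _ ⟨f, rfl⟩ _ (⟨g, rfl⟩ | ⟨a, rfl⟩) <;>
      rw [dotProduct_indicatorVec, ZMod.natCast_eq_zero_iff_even]
    · exact hG.even_inter f g
    · exact hG.even_inter_boundary f a
  obtain ⟨h1, h2⟩ := eq_orthogonal_of_finrank hn horth (by omega) (by
    change Fintype.card G.Vertex = _ at hn
    change Fintype.card D = 3 * Fintype.card G.Vertex at hD
    change Fintype.card D + 4 ≤ 2 * (Fintype.card G.Vertex + _) at heuler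
    refine le_trans (Nat.le_of_succ_le_succ (le_trans ?_ hrank)) hmono
    omega)
  exact ⟨by omega, h2⟩

end CylinderDecomposition

open MajoranaModes in
theorem lemma4 {D : Type*} [Finite D] (G : CylinderDecomposition D) (hG : G.IsColorGraph)
    [LinearOrder G.Vertex] {H : Type*} [NormedAddCommGroup H] [InnerProductSpace ℂ H]
    (M : MajoranaModes G.Vertex H) :
    (∃ S, G.IsColorCode M S) ∧
    ∀ S, G.IsColorCode M S →
      M.IsCode S ∧
      M.EncodesQubits S 1 ∧
      Module.finrank ℂ (M.codespace S) = 2 ^ 1 ∧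
      (∀ a, Odd (G.boundaryVertices a).card ∧ M.IsLogical S (G.boundaryOperator M a)) ∧
      ∃ η : Fin 2 → rootsOfUnity 4 ℂ,
        ∀ X Y Z, X = MajoranaModes.scalar H (η 0 : ℂˣ) * G.boundaryOperator M 0 →
          Y = MajoranaModes.scalar H (η 1 : ℂˣ) * G.boundaryOperator M 1 →
          Z = (MajoranaModes.scalar H MajoranaModes.iUnit)⁻¹ * X * Y →
          M.IsLogicalPauli S X Y Z := by
  have : Fintype G.Vertex := Fintype.ofFinite _
  constructor
  · have : Finite G.Face := inferInstanceAs (Finite {f : G.toCombinatorialMap.Face // _})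
    obtain ⟨η, hcomm, hneg⟩ := M.exists_phases (fun f : G.Face => G.faceVertices f) fun f g =>
      M.op_commute_of_even (((hG.even_faceVertices f).mul_right _).add (hG.even_inter f g))
    exact ⟨_, ⟨η, rfl⟩, hcomm, hneg⟩
  · rintro S ⟨⟨η, hS⟩, hcomm, hneg⟩
    have hW : M.HasSupportSpace S G.faceSpan := HasSupportSpace.of_closure hS hneg
    obtain ⟨hrank, hperp⟩ := hG.finrank_faceSpan
    have heven := fun A => hG.even_of_mem_faceSpan (A := A)
    have hbdry : ∀ a, M.HasSupport (G.boundaryOperator M a) (G.boundaryVertices a) :=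
      fun a => hasSupport_op _
    have hcent : ∀ a, G.boundaryOperator M a ∈ M.centralizer S := fun a =>
      (hW.mem_centralizer heven (hbdry a)).2 (hG.dotProduct_boundary a)
    have hdisj := G.disjoint_boundaryVertices
    refine ⟨⟨fun P hP => ?_, hcomm, hneg, fun P hP A hA => heven A (hW.indicatorVec_mem hP hA)⟩,
      ?_, ?_, fun a => ⟨hG.odd_boundaryVertices a, hcent a, fun h => ?_⟩, ?_⟩
    · obtain ⟨A, hA, -⟩ := hW.exists_support P hP
      exact hA.mem_majoranaGroup
    · obtain ⟨g, hg, hind⟩ := hW.exists_generators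
      exact ⟨_, g, by rw [Nat.card_eq_fintype_card, hrank], hg, hind⟩
    · have hdim := hW.finrank_codespace
      obtain ⟨n, hn, hH⟩ := M.dim
      rw [Nat.card_eq_fintype_card, ← hrank] at hn
      rw [hH, ← Nat.eq_of_mul_eq_mul_left two_pos hn, add_comm, pow_add] at hdim
      exact Nat.eq_of_mul_eq_mul_right (by positivity) hdim
    · exact Nat.not_even_iff_odd.2 (hG.odd_boundaryVertices a)
        (heven _ (hW.indicatorVec_mem h (hbdry a)))
    · choose η hη using fun a => M.exists_phase_mul_self (G.boundaryVertices a)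
      refine ⟨η, fun X Y Z hX hY hZ => ?_⟩
      subst hX hY
      exact hW.isLogicalPauli hcomm heven hG.odd_boundaryVertices hdisj hG.dotProduct_boundary
        hperp ((hbdry 0).smul (η 0).2) ((hbdry 1).smul (η 1).2) (hη 0) (hη 1) hZ
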